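/- Let $\zeta(\Delta,s)$ denote the spectral zeta function of the Laplace–Beltrami operator on the torus $\mathbb{T}^2=(\mathbb{R}/2\pi\mathbb{Z})^2$, i.e. the analytic continuation to $\mathbb{C}\setminus\{1\}$ of $$\zeta(\Delta,s)=\sum_{(k_1,k_2)\in\mathbb{Z}^2\setminus\{0\}}(k_1^2+k_2^2)^{-s},\qquad \mathrm{Re}(s)>1,$$ and put $$\Omega(s)=\tfrac13\,s\,\pi^{2-s}\,\Gamma(s)\,\zeta(\Delta,s-1),\qquad \rho(s)=\left|\frac{\zeta(\Delta,2-s)}{\zeta(\Delta,-s)}\right|,\qquad \eta(s)=\left|\frac{\zeta(\Delta,s+1)}{\zeta(\Delta,s-1)}\right|.$$ (i) For every $s\in\mathbb{C}$ with $0<\mathrm{Re}(s)<1$ and $\mathrm{Im}(s)>65$ one has $\Omega(s)\neq0$, $\Omega(1-s)\neq 0$, and $$\left|\frac{\Omega(1-s)}{\Omega(s)}\right|=1\quad\text{if and only if}\quad \mathrm{Re}(s)=\tfrac12 .$$ (ii) For every fixed real $b>65$, writing $s=a+ib$: the function $a\mapsto|\Omega(1-s)/\Omega(s)|$ is strictly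 increasing on $(0,1)$; the function $a\mapsto\rho(s)$ is strictly decreasing on $(0,\tfrac12)$; and the function $a\mapsto\eta(s)$ is strictly increasing on $(\tfrac12,1)$. -/

import Mathlib

namespace TorusZeta

open Complex Set Filter Topology Asymptotics

/-- The term `(k₁² + k₂²)^(-s)` belonging to the eigenvalue `k₁² + k₂²` of the Laplace-Beltrami
operator `Δ` on the flat torus `𝕋² = (ℝ / 2πℤ)²` (eigenfunction `exp (i (k₁ x₁ + k₂ x₂))`). -/
noncomputable def eigTerm (s : ℂ) (k : ℤ × ℤ) : ℂ :=
  ((k.1 ^ 2 + k.2 ^ 2 : ℤ) : ℂ) ^ (-s)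

/-- `Z` is the analytic continuation to `ℂ ∖ {1}` of the spectral zeta function of `Δ`, i.e. of
`∑ (k₁² + k₂²)^(-s)` over `k ∈ ℤ² ∖ {0}` (nonzero eigenvalues with multiplicity), a sum that
converges absolutely for `Re s > 1`. -/
def IsSpectralZeta (Z : ℂ → ℂ) : Prop :=
  DifferentiableOn ℂ Z {1}ᶜ ∧
    ∀ s : ℂ, 1 < s.re → HasSum (fun k : {k : ℤ × ℤ // k ≠ 0} ↦ eigTerm s k) (Z s)

/-- The functional-equation pair of the two-dimensional theta function
`t ↦ ∑_{k ∈ ℤ²} exp (-π (k₁² + k₂²) t)`. -/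
noncomputable def thetaPair : WeakFEPair ℂ where
  f x := (HurwitzZeta.evenKernel 0 x : ℂ) ^ 2
  g x := (HurwitzZeta.evenKernel 0 x : ℂ) ^ 2
  k := 1
  ε := 1
  f₀ := 1
  g₀ := 1
  hf_int := ((continuous_ofReal.comp_continuousOn
    (HurwitzZeta.continuousOn_evenKernel 0)).pow 2).locallyIntegrableOn measurableSet_Ioi
  hg_int := ((continuous_ofReal.comp_continuousOn
    (HurwitzZeta.continuousOn_evenKernel 0)).pow 2).locallyIntegrableOn measurableSet_Ioi
  hk := one_pos
  hε := one_ne_zero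
  h_feq x hx := by
    have hx' : (0 : ℝ) < x := hx
    have h := HurwitzZeta.evenKernel_functional_equation 0 (1 / x)
    rw [← HurwitzZeta.evenKernel_eq_cosKernel_of_zero, one_div_one_div] at h
    have h2 : (((1 / x) ^ (1 / 2 : ℝ)) ^ 2 : ℝ) = 1 / x := by
      rw [← Real.sqrt_eq_rpow, Real.sq_sqrt (by positivity)]
    have h3 : (HurwitzZeta.evenKernel 0 (1 / x)) ^ 2 = x * HurwitzZeta.evenKernel 0 x ^ 2 := by
      rw [h, mul_pow, div_pow, one_pow, h2, one_div_one_div]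
    simp only [Real.rpow_one, one_mul, smul_eq_mul]
    exact_mod_cast h3
  hf_top r := by
    have h0 (r : ℝ) := (HurwitzZeta.hurwitzEvenFEPair 0).hf_top r
    simp only [HurwitzZeta.hurwitzEvenFEPair, if_true, Function.comp_apply] at h0
    have h1 : (fun x : ℝ ↦ (HurwitzZeta.evenKernel 0 x : ℂ) + 1) =O[atTop] (fun _ ↦ (1 : ℝ)) := by
      have := (h0 0).add (isBigO_const_const (2 : ℂ) (one_ne_zero (α := ℝ)) atTop |>.congr_right
        (fun x ↦ (Real.rpow_zero x).symm))
      refine this.congr (fun x ↦ by ring) (fun x ↦ Real.rpow_zero x)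
    refine ((h0 r).mul h1).congr (fun x ↦ by ring) (fun x ↦ mul_one _)
  hg_top r := by
    have h0 (r : ℝ) := (HurwitzZeta.hurwitzEvenFEPair 0).hf_top r
    simp only [HurwitzZeta.hurwitzEvenFEPair, if_true, Function.comp_apply] at h0
    have h1 : (fun x : ℝ ↦ (HurwitzZeta.evenKernel 0 x : ℂ) + 1) =O[atTop] (fun _ ↦ (1 : ℝ)) := by
      have := (h0 0).add (isBigO_const_const (2 : ℂ) (one_ne_zero (α := ℝ)) atTop |>.congr_right
        (fun x ↦ (Real.rpow_zero x).symm))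
      refine this.congr (fun x ↦ by ring) (fun x ↦ Real.rpow_zero x)
    refine ((h0 r).mul h1).congr (fun x ↦ by ring) (fun x ↦ mul_one _)

theorem hasSum_theta {t : ℝ} (ht : 0 < t) :
    HasSum (fun k : ℤ × ℤ ↦ Real.exp (-Real.pi * ((k.1 ^ 2 + k.2 ^ 2 : ℤ) : ℝ) * t))
      (HurwitzZeta.evenKernel 0 t ^ 2) := by
  have h := HurwitzZeta.hasSum_int_evenKernel 0 ht
  simp only [add_zero, QuotientAddGroup.mk_zero] at h
  have hs := h.summable.mul_of_nonneg h.summable (fun _ ↦ (Real.exp_pos _).le)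
    (fun _ ↦ (Real.exp_pos _).le)
  have := h.mul h hs
  rw [sq]
  refine this.congr_fun (fun k ↦ ?_)
  rw [← Real.exp_add]
  push_cast
  ring_nf

theorem summable_eig {σ : ℝ} (hσ : 1 < σ) :
    Summable fun k : ℤ × ℤ ↦ ((k.1 ^ 2 + k.2 ^ 2 : ℤ) : ℝ) ^ (-σ) := by
  have h := EisensteinSeries.summable_one_div_norm_rpow (k := 2 * σ) (by linarith)
  rw [← (finTwoArrowEquiv ℤ).symm.summable_iff] at h
  have hnn (k : ℤ × ℤ) : (0 : ℝ) ≤ ((k.1 ^ 2 + k.2 ^ 2 : ℤ) : ℝ) := by push_cast; positivity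
  refine h.of_nonneg_of_le (fun k ↦ Real.rpow_nonneg (hnn k) _) (fun k ↦ ?_)
  rcases eq_or_ne k 0 with rfl | hk
  · simp only [Prod.fst_zero, Prod.snd_zero]
    rw [show ((0 ^ 2 + 0 ^ 2 : ℤ) : ℝ) = 0 by simp, Real.zero_rpow (by linarith)]
    exact Real.rpow_nonneg (norm_nonneg _) _
  · set v := (finTwoArrowEquiv ℤ).symm k with hv
    have hv0 : v ≠ 0 := by
      intro h0
      apply hk
      have := congrArg (finTwoArrowEquiv ℤ) h0
      rw [hv, Equiv.apply_symm_apply] at this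
      rw [this]; rfl
    have hpos : 0 < ‖v‖ := norm_pos_iff.mpr hv0
    have hle : ‖v‖ ^ 2 ≤ ((k.1 ^ 2 + k.2 ^ 2 : ℤ) : ℝ) := by
      obtain ⟨i, hi⟩ := (Finite.exists_max (fun i ↦ ‖v i‖))
      have h1 : ‖v‖ ≤ ‖v i‖ := (pi_norm_le_iff_of_nonneg (norm_nonneg _)).mpr hi
      have h2 : ‖v i‖ ^ 2 ≤ ((k.1 ^ 2 + k.2 ^ 2 : ℤ) : ℝ) := by
        rw [Int.norm_eq_abs, sq_abs]
        push_cast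
        fin_cases i
        · change (k.1 : ℝ) ^ 2 ≤ _
          nlinarith [sq_nonneg (k.2 : ℝ)]
        · change (k.2 : ℝ) ^ 2 ≤ _
          nlinarith [sq_nonneg (k.1 : ℝ)]
      exact (pow_le_pow_left₀ hpos.le h1 2).trans h2
    calc ((k.1 ^ 2 + k.2 ^ 2 : ℤ) : ℝ) ^ (-σ) ≤ (‖v‖ ^ 2) ^ (-σ) :=
          Real.rpow_le_rpow_of_nonpos (by positivity) hle (by linarith)
      _ = ‖v‖ ^ (-(2 * σ)) := by
          rw [← Real.rpow_natCast, ← Real.rpow_mul hpos.le]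
          congr 1; push_cast; ring

theorem hasSum_thetaPair {s : ℂ} (hs : 1 < s.re) :
    HasSum (fun k : {k : ℤ × ℤ // k ≠ 0} ↦ eigTerm s k)
      ((Real.pi : ℂ) ^ s * (Gamma s)⁻¹ * thetaPair.Λ s) := by
  have hs0 : 0 < s.re := by linarith
  have hpi : (Real.pi : ℂ) ^ s ≠ 0 := by simp [cpow_eq_zero_iff, Real.pi_ne_zero]
  have hG : Gamma s ≠ 0 := Gamma_ne_zero_of_re_pos hs0
  have hq (k : {k : ℤ × ℤ // k ≠ 0}) : (0 : ℝ) < ((k.1.1 ^ 2 + k.1.2 ^ 2 : ℤ) : ℝ) := by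
    obtain ⟨⟨a, b⟩, hk⟩ := k
    have : a ≠ 0 ∨ b ≠ 0 := by
      by_contra! h
      exact hk (by rw [h.1, h.2]; rfl)
    have h2 : 0 < a ^ 2 + b ^ 2 := by rcases this with h | h <;> positivity
    exact_mod_cast h2
  have hM := hasSum_mellin_pi_mul (a := fun _ : {k : ℤ × ℤ // k ≠ 0} ↦ (1 : ℂ))
    (q := fun k ↦ ((k.1.1 ^ 2 + k.1.2 ^ 2 : ℤ) : ℝ))
    (F := fun t ↦ thetaPair.f t - thetaPair.f₀) (s := s) (fun k ↦ Or.inr (hq k)) hs0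
    (fun t ht ↦ ?_) ?_
  · rw [(thetaPair.hasMellin (s := s) (by simpa [thetaPair] using hs)).2] at hM
    refine (hM.mul_left ((Real.pi : ℂ) ^ s * (Gamma s)⁻¹)).congr_fun (fun k ↦ ?_)
    rw [eigTerm, cpow_neg, cpow_neg]
    push_cast
    field_simp
  · have h := hasSum_theta (t := t) ht
    have h' := Complex.hasSum_ofReal.mpr h
    have h'' := (Finset.hasSum_compl_iff {(0 : ℤ × ℤ)}
      (f := fun k : ℤ × ℤ ↦
        ((Real.exp (-Real.pi * ((k.1 ^ 2 + k.2 ^ 2 : ℤ) : ℝ) * t) : ℝ) : ℂ))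
      (a := thetaPair.f t - thetaPair.f₀)).mpr (by
        simpa [thetaPair] using h')
    let e : {k : ℤ × ℤ // k ≠ 0} ≃ {k : ℤ × ℤ // k ∉ ({0} : Finset (ℤ × ℤ))} :=
      Equiv.subtypeEquivRight (fun k ↦ by simp)
    refine (e.hasSum_iff.mpr h'').congr_fun (fun k ↦ ?_)
    simp [e]
  · have h := (summable_eig hs).comp_injective
      (Subtype.val_injective (p := fun k : ℤ × ℤ ↦ k ≠ 0))
    refine h.congr (fun k ↦ ?_)
    simp only [norm_one, Function.comp_apply]
    rw [Real.rpow_neg (hq k).le, one_div]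

theorem exists_isSpectralZeta : ∃ Z : ℂ → ℂ, IsSpectralZeta Z := by
  have hpi : (Real.pi : ℂ) ≠ 0 := by simp [Real.pi_ne_zero]
  refine ⟨fun s ↦ (Real.pi : ℂ) ^ s * ((Gamma s)⁻¹ * thetaPair.Λ₀ s - (Gamma (s + 1))⁻¹
    - (Gamma s)⁻¹ * (1 - s)⁻¹), fun s hs ↦ ?_, fun s hs ↦ ?_⟩
  · have h1 : DifferentiableAt ℂ (fun s : ℂ ↦ (Gamma s)⁻¹) s := differentiable_one_div_Gamma s
    have h2 : DifferentiableAt ℂ (fun s : ℂ ↦ (Gamma (s + 1))⁻¹) s :=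
      (differentiable_one_div_Gamma.comp (differentiable_id.add_const (1 : ℂ))) s
    have h3 : DifferentiableAt ℂ thetaPair.Λ₀ s := thetaPair.differentiable_Λ₀ s
    have h4 : DifferentiableAt ℂ (fun s : ℂ ↦ (1 - s)⁻¹) s :=
      DifferentiableAt.inv (by fun_prop) (sub_ne_zero.mpr (Ne.symm hs))
    have h5 : DifferentiableAt ℂ (fun s : ℂ ↦ (Real.pi : ℂ) ^ s) s :=
      DifferentiableAt.const_cpow differentiableAt_id (Or.inl hpi)
    exact (h5.mul (((h1.mul h3).sub h2).sub (h1.mul h4))).differentiableWithinAt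
  · have h := hasSum_thetaPair hs
    have hs0 : s ≠ 0 := by rintro rfl; simp at hs; linarith
    convert h using 1
    beta_reduce
    rw [WeakFEPair.Λ, Gamma_add_one s hs0]
    simp only [thetaPair, smul_eq_mul, mul_one, ofReal_one, mul_inv]
    ring

/-- The continuation is unique. -/
theorem IsSpectralZeta.eqOn {Z W : ℂ → ℂ} (hZ : IsSpectralZeta Z) (hW : IsSpectralZeta W) :
    EqOn Z W {1}ᶜ := by
  have hU : IsOpen ({1}ᶜ : Set ℂ) := isOpen_compl_singleton
  refine (hZ.1.analyticOnNhd hU).eqOn_of_preconnected_of_eventuallyEq (hW.1.analyticOnNhd hU)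
    (isConnected_compl_singleton_of_one_lt_rank (by simp) 1).isPreconnected
    (z₀ := 2) (by simp) ?_
  filter_upwards [(isOpen_lt continuous_const continuous_re).mem_nhds
    (show (1 : ℝ) < (2 : ℂ).re by simp)] with s hs
  exact (hZ.2 s hs).unique (hW.2 s hs)

/-- The spectral zeta function `ζ(Δ, s)` of the Laplace-Beltrami operator on the two-dimensional
torus, continued to `ℂ ∖ {1}`. Its value at the pole `s = 1` is arbitrary. -/
noncomputable def zeta : ℂ → ℂ := Classical.choose exists_isSpectralZeta

theorem isSpectralZeta_zeta : IsSpectralZeta zeta := Classical.choose_spec exists_isSpectralZeta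

/-- `Ω(s) = (1/3) s π^(2-s) Γ(s) ζ(Δ, s-1)`. -/
noncomputable def Omega (s : ℂ) : ℂ :=
  1 / 3 * s * (Real.pi : ℂ) ^ (2 - s) * Gamma s * zeta (s - 1)

/-- `ρ(s) = |ζ(Δ, 2-s) / ζ(Δ, -s)|`. -/
noncomputable def rho (s : ℂ) : ℝ := ‖zeta (2 - s) / zeta (-s)‖

/-- `η(s) = |ζ(Δ, s+1) / ζ(Δ, s-1)|`. -/
noncomputable def eta (s : ℂ) : ℝ := ‖zeta (s + 1) / zeta (s - 1)‖

end TorusZeta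

/-!
Write `Λ(w) = π^(-w) Γ(w) ζ(Δ, w)` for the completed zeta function. The functional equation
`Λ(1 - w) = Λ(w)` and the recursion of `Γ` give `Ω(s) = (π/3) s (s - 1) Λ(2 - s)`, hence

* `‖Ω(1 - s) / Ω(s)‖ = ‖Λ(1 + s)‖ / ‖Λ(2 - s)‖ =: Q`,
* `ρ(s) = π² / (Q ‖s‖ ‖1 - s‖)`, and `η` at `a + ib` equals `ρ` at `1 - a + ib`.

Both arguments `1 + s` and `2 - s` lie in the half-plane of absolute convergence, where the Euler
product over the Gaussian primes excludes zeros. As `a ↦ 1 - a` inverts `Q`, all claims follow once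
`log Q` grows on `(0, 1/2]` at a rate that is bounded below by a constant (`logQuot_growth`) and
dominates the variation of `‖s‖` and `‖1 - s‖`, which is of order `1 / b²`.

Two facts give this growth.

* The modulus of `xi(w) = w (w - 1) Λ(w)` is non-decreasing in `Re w > 1` (`norm_xi_mono`). This
  takes care of `1 + s`, whose real part may be close to `1`, where no bound for the logarithmic
  derivative of `ζ(Δ, ·)` is available from the Dirichlet series. No product over the zeros is used:
  for `σ > 1` the quotient `xi(2σ - w) / xi(w)` is holomorphic for `Re w ≥ σ`, has modulus `1` on the
  line `Re w = σ` and modulus at most `1` far to the right, so it is bounded by `1` in between by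
  the Phragmén–Lindelöf principle.
* `log ‖Λ(x + iy)‖` grows at rate at least `1/10` for `3/2 ≤ x ≤ 2` and `y > 65`
  (`log_norm_Λ_growth`), which takes care of `2 - s`. By the Euler product
  `‖ζ(Δ, x + iy)‖ / ‖ζ(Δ, x)‖` increases with `x` (`norm_zeta_mul_le`), so it suffices to control
  `ζ(Δ, x)` for real `x`, and this is again the monotonicity of `xi`, now on the real axis. What
  remains is that `‖Γ(x + iy)‖ / Γ(x)` outgrows `x (x - 1)` (`log_norm_Gamma_growth`), which is seen
  on finitely many factors of Euler's product for `Γ`.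
-/

namespace TorusZeta

open Complex Set Filter Topology Asymptotics

/-! ### The Euler product over the Gaussian integers -/

/-- The term `N(z)^(-w)` of the Dirichlet series over the Gaussian integers. For `w ≠ 0` it vanishes
at `z = 0`, so sums may run over all of `ℤ[i]`. -/
noncomputable def normTerm (w : ℂ) (z : GaussianInt) : ℂ := ((z.norm : ℝ) : ℂ) ^ (-w)

theorem normTerm_zero {w : ℂ} (hw : w ≠ 0) : normTerm w 0 = 0 := by
  simp [normTerm, zero_cpow (neg_ne_zero.mpr hw)]

theorem normTerm_mul (w : ℂ) (z v : GaussianInt) :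
    normTerm w (z * v) = normTerm w z * normTerm w v := by
  have hz : (0 : ℝ) ≤ z.norm := by exact_mod_cast GaussianInt.norm_nonneg z
  have hv : (0 : ℝ) ≤ v.norm := by exact_mod_cast GaussianInt.norm_nonneg v
  rw [normTerm, Zsqrtd.norm_mul, Int.cast_mul, ofReal_mul, mul_cpow_ofReal_nonneg hz hv]
  rfl

theorem norm_normTerm {w : ℂ} (hw : w.re ≠ 0) (z : GaussianInt) :
    ‖normTerm w z‖ = (z.norm : ℝ) ^ (-w.re) := by
  rw [normTerm, norm_cpow_eq_rpow_re_of_nonneg (by exact_mod_cast GaussianInt.norm_nonneg z)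
    (by simpa using hw), neg_re]

theorem summable_norm_rpow {σ : ℝ} (hσ : 1 < σ) :
    Summable fun z : GaussianInt ↦ (z.norm : ℝ) ^ (-σ) := by
  let e : GaussianInt ≃ ℤ × ℤ :=
    ⟨fun z ↦ (z.re, z.im), fun k ↦ ⟨k.1, k.2⟩, fun _ ↦ rfl, fun _ ↦ rfl⟩
  refine (e.summable_iff.mpr (summable_eig hσ)).congr fun z ↦ ?_
  simp [e, Zsqrtd.norm_def, sq]

theorem summable_normTerm {w : ℂ} (hw : 1 < w.re) : Summable (normTerm w) := by
  refine Summable.of_norm ((summable_norm_rpow hw).congr fun z ↦ ?_)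
  rw [norm_normTerm (by linarith)]

theorem hasSum_normTerm {w : ℂ} (hw : 1 < w.re) : HasSum (normTerm w) (zeta w) := by
  have hw0 : w ≠ 0 := by rintro rfl; simp at hw; linarith
  have h := isSpectralZeta_zeta.2 w hw
  have h2 : HasSum (fun k : ℤ × ℤ ↦ eigTerm w k) (zeta w) := by
    refine (hasSum_subtype_iff_of_support_subset (s := {k : ℤ × ℤ | k ≠ 0}) ?_).mp h
    intro k hk (hk0 : k = 0)
    apply hk
    simp [hk0, eigTerm, hw0]
  let e : GaussianInt ≃ ℤ × ℤ :=
    ⟨fun z ↦ (z.re, z.im), fun k ↦ ⟨k.1, k.2⟩, fun _ ↦ rfl, fun _ ↦ rfl⟩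
  refine (e.hasSum_iff.mpr h2).congr_fun fun z ↦ ?_
  have hz : z.norm = z.re ^ 2 + z.im ^ 2 := by rw [Zsqrtd.norm_def]; ring
  simp only [normTerm, hz, Function.comp_apply, eigTerm, e, Equiv.coe_fn_mk, ofReal_intCast]

/-- Multiplying the Dirichlet series by the Euler factors of finitely many primes, no two of them
associated, sifts out the multiples of these primes. -/
theorem prod_mul_zeta_eq_tsum {w : ℂ} (hw : 1 < w.re) (T : Finset GaussianInt)
    (hT : ∀ p ∈ T, Prime p) (hT' : ∀ p ∈ T, ∀ q ∈ T, Associated p q → p = q) :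
    (∏ p ∈ T, (1 - normTerm w p)) * zeta w
      = ∑' z, {z : GaussianInt | ∀ p ∈ T, ¬ p ∣ z}.indicator (normTerm w) z := by
  classical
  induction T using Finset.induction_on with
  | empty => simp [(hasSum_normTerm hw).tsum_eq]
  | insert p T hpT ih =>
    have hp := hT p (Finset.mem_insert_self p T)
    have ih := ih (fun q hq ↦ hT q (Finset.mem_insert_of_mem hq))
      (fun q hq r hr ↦ hT' q (Finset.mem_insert_of_mem hq) r (Finset.mem_insert_of_mem hr))
    set U : Set GaussianInt := {z | ∀ q ∈ T, ¬ q ∣ z} with hU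
    have hmem (z : GaussianInt) : p * z ∈ U ↔ z ∈ U := by
      refine forall₂_congr fun q hq ↦ not_congr ⟨fun h ↦ ?_, fun h ↦ h.mul_left p⟩
      have hq' := hT q (Finset.mem_insert_of_mem hq)
      refine (hq'.dvd_or_dvd h).resolve_left fun hqp ↦ hpT ?_
      rwa [← hT' q (Finset.mem_insert_of_mem hq) p (Finset.mem_insert_self p T)
        (hq'.associated_of_dvd hp hqp)]
    have hinj : Function.Injective (fun z : GaussianInt ↦ p * z) := mul_right_injective₀ hp.ne_zero
    have hsum : Summable (U.indicator (normTerm w)) := (summable_normTerm hw).indicator U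
    have h1 : normTerm w p * ∑' z, U.indicator (normTerm w) z
        = ∑' z, {z | p ∣ z}.indicator (U.indicator (normTerm w)) z := by
      rw [← tsum_mul_left]
      have hsupp : Function.support ({z | p ∣ z}.indicator (U.indicator (normTerm w)))
          ⊆ range (fun z ↦ p * z) := by
        intro z hz
        obtain ⟨v, rfl⟩ : z ∈ {z | p ∣ z} := mem_of_indicator_ne_zero (Function.mem_support.mp hz)
        exact ⟨v, rfl⟩
      rw [← hinj.tsum_eq hsupp]
      refine tsum_congr fun z ↦ ?_
      rw [indicator_of_mem (show p * z ∈ {z | p ∣ z} from Dvd.intro z rfl)]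
      by_cases hz : z ∈ U
      · rw [indicator_of_mem hz, indicator_of_mem ((hmem z).mpr hz), normTerm_mul]
      · rw [indicator_of_notMem hz, indicator_of_notMem (mt (hmem z).mp hz), mul_zero]
    rw [Finset.prod_insert hpT, mul_assoc, ih, sub_mul, one_mul, h1,
      ← hsum.tsum_sub (hsum.indicator {z | p ∣ z})]
    refine tsum_congr fun z ↦ ?_
    by_cases hz : p ∣ z
    · rw [indicator_of_mem (show z ∈ {z | p ∣ z} from hz), sub_self, indicator_of_notMem]
      exact fun h ↦ h p (Finset.mem_insert_self p T) hz
    · rw [indicator_of_notMem (show z ∉ {z | p ∣ z} from hz), sub_zero]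
      by_cases hzU : z ∈ U
      · rw [indicator_of_mem hzU, indicator_of_mem]
        intro q hq
        rcases Finset.mem_insert.mp hq with rfl | hq
        exacts [hz, hzU q hq]
      · rw [indicator_of_notMem hzU, indicator_of_notMem]
        exact fun h ↦ hzU fun q hq ↦ h q (Finset.mem_insert_of_mem hq)

theorem finite_norm_le (B : ℕ) : {z : GaussianInt | z.norm ≤ B}.Finite := by
  have h : ((Icc (-(B : ℤ)) B ×ˢ Icc (-(B : ℤ)) B).image
      (fun k : ℤ × ℤ ↦ (⟨k.1, k.2⟩ : GaussianInt))).Finite :=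
    ((finite_Icc _ _).prod (finite_Icc _ _)).image _
  refine h.subset fun z hz ↦ ⟨(z.re, z.im), ?_, rfl⟩
  have hz : z.norm ≤ B := hz
  rw [Zsqrtd.norm_def] at hz
  refine ⟨⟨?_, ?_⟩, ⟨?_, ?_⟩⟩ <;> dsimp only <;> nlinarith [sq_nonneg z.re, sq_nonneg z.im]

/-- A family of finite sets of pairwise non-associated Gaussian primes that exhausts all of them,
up to units. -/
theorem exists_primes_exhaustion : ∃ S : ℕ → Finset GaussianInt,
    (∀ B, ∀ p ∈ S B, Prime p) ∧ (∀ B, ∀ p ∈ S B, ∀ q ∈ S B, Associated p q → p = q) ∧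
    ∀ z : GaussianInt, z ≠ 0 → ¬ IsUnit z → ∀ᶠ B in atTop, ∃ p ∈ S B, p ∣ z := by
  classical
  let r : GaussianInt → GaussianInt := fun z ↦ Quot.out (Associates.mk z)
  have hr (z : GaussianInt) : Associated (r z) z := Associates.mk_eq_mk_iff_associated.mp
    (Quot.out_eq (Associates.mk z))
  have hr' (z v : GaussianInt) (h : Associated z v) : r z = r v := by
    simp only [r, Associates.mk_eq_mk_iff_associated.mpr h]
  refine ⟨fun B ↦ ((finite_norm_le B).toFinset.filter Prime).image r, fun B p hp ↦ ?_,
    fun B p hp q hq hpq ↦ ?_, fun z hz hzu ↦ ?_⟩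
  · obtain ⟨z, hz, rfl⟩ := Finset.mem_image.mp hp
    exact (hr z).symm.prime (Finset.mem_filter.mp hz).2
  · obtain ⟨z, hz, rfl⟩ := Finset.mem_image.mp hp
    obtain ⟨v, hv, rfl⟩ := Finset.mem_image.mp hq
    exact hr' z v (((hr z).symm.trans hpq).trans (hr v))
  · obtain ⟨p, hp, hpz⟩ := WfDvdMonoid.exists_irreducible_factor hzu hz
    filter_upwards [eventually_ge_atTop p.norm.toNat] with B hB
    refine ⟨r p, Finset.mem_image.mpr ⟨p, Finset.mem_filter.mpr ⟨?_, hp.prime⟩, rfl⟩,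
      (hr p).dvd.trans hpz⟩
    simp only [Finite.mem_toFinset, mem_ofPred_eq]
    omega

theorem one_lt_norm_of_prime {p : GaussianInt} (hp : Prime p) : 1 < p.norm := by
  have h0 : 0 < p.norm := GaussianInt.norm_pos.mpr hp.ne_zero
  have h1 : p.norm ≠ 1 := fun h ↦ hp.not_isUnit ((Zsqrtd.norm_eq_one_iff' (by norm_num) p).mp h)
  omega

/-- The Euler product of `ζ(Δ, w)`: the finite products of Euler factors times `ζ(Δ, w)` converge to
a positive constant (the number of units) that does not depend on `w`. -/
theorem exists_tendsto_prod_mul_zeta : ∃ (S : ℕ → Finset GaussianInt) (c : ℝ), 0 < c ∧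
    (∀ B, ∀ p ∈ S B, 1 < p.norm) ∧ ∀ w : ℂ, 1 < w.re →
      Tendsto (fun B ↦ (∏ p ∈ S B, (1 - normTerm w p)) * zeta w) atTop (𝓝 (c : ℂ)) := by
  obtain ⟨S, hS, hS', hS''⟩ := exists_primes_exhaustion
  have hunit (w : ℂ) (z : GaussianInt) (hz : IsUnit z) : normTerm w z = 1 := by
    rw [normTerm, (Zsqrtd.norm_eq_one_iff' (by norm_num) z).mpr hz]
    simp
  refine ⟨S, ∑' z : GaussianInt, {z : GaussianInt | IsUnit z}.indicator (fun _ ↦ (1 : ℝ)) z, ?_,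
    fun B p hp ↦ one_lt_norm_of_prime (hS B p hp), fun w hw ↦ ?_⟩
  · have hs : Summable ({z : GaussianInt | IsUnit z}.indicator (fun _ ↦ (1 : ℝ))) := by
      refine ((summable_norm_rpow one_lt_two).indicator {z : GaussianInt | IsUnit z}).congr
        fun z ↦ ?_
      by_cases hz : IsUnit z
      · rw [indicator_of_mem (show z ∈ {z | IsUnit z} from hz),
          indicator_of_mem (show z ∈ {z | IsUnit z} from hz),
          (Zsqrtd.norm_eq_one_iff' (by norm_num) z).mpr hz]
        simp
      · rw [indicator_of_notMem (show z ∉ {z | IsUnit z} from hz),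
          indicator_of_notMem (show z ∉ {z | IsUnit z} from hz)]
    refine hs.tsum_pos (fun z ↦ indicator_nonneg (fun _ _ ↦ zero_le_one) z) 1 ?_
    rw [indicator_of_mem (show (1 : GaussianInt) ∈ {z | IsUnit z} from isUnit_one)]
    exact one_pos
  · have hw0 : w ≠ 0 := by rintro rfl; simp at hw; linarith
    simp_rw [fun B ↦ prod_mul_zeta_eq_tsum hw (S B) (hS B) (hS' B)]
    have hlim : (((∑' z : GaussianInt, {z : GaussianInt | IsUnit z}.indicator
        (fun _ ↦ (1 : ℝ)) z : ℝ)) : ℂ)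
        = ∑' z, {z : GaussianInt | IsUnit z}.indicator (normTerm w) z := by
      rw [ofReal_tsum]
      refine tsum_congr fun z ↦ ?_
      by_cases hz : IsUnit z
      · rw [indicator_of_mem (show z ∈ {z | IsUnit z} from hz),
          indicator_of_mem (show z ∈ {z | IsUnit z} from hz), hunit w z hz, ofReal_one]
      · rw [indicator_of_notMem (show z ∉ {z | IsUnit z} from hz),
          indicator_of_notMem (show z ∉ {z | IsUnit z} from hz), ofReal_zero]
    rw [hlim]
    refine tendsto_tsum_of_dominated_convergence (summable_normTerm hw).norm (fun z ↦ ?_)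
      (Eventually.of_forall fun B z ↦ norm_indicator_le_norm_self _ _)
    by_cases hz : IsUnit z
    · rw [indicator_of_mem (show z ∈ {z | IsUnit z} from hz)]
      refine tendsto_const_nhds.congr fun B ↦ ?_
      rw [indicator_of_mem]
      exact fun p hp hpz ↦ (hS B p hp).not_isUnit (isUnit_of_dvd_unit hpz hz)
    · rw [indicator_of_notMem (show z ∉ {z | IsUnit z} from hz)]
      rcases eq_or_ne z 0 with rfl | hz0
      · refine tendsto_const_nhds.congr fun B ↦ ?_
        rw [indicator_apply_eq_zero.mpr fun _ ↦ normTerm_zero hw0]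
      · refine tendsto_const_nhds.congr' ?_
        filter_upwards [hS'' z hz0 hz] with B ⟨p, hp, hpz⟩
        rw [indicator_of_notMem]
        exact fun h ↦ h p hp hpz

theorem normTerm_ofReal (x : ℝ) (z : GaussianInt) :
    normTerm x z = (((z.norm : ℝ) ^ (-x) : ℝ) : ℂ) := by
  rw [normTerm, ofReal_cpow (by exact_mod_cast GaussianInt.norm_nonneg z), ofReal_neg]

theorem norm_prod_mul_norm_prod_le_one {w : ℂ} (hw : 1 < w.re) (T : Finset GaussianInt)
    (hT : ∀ p ∈ T, 1 < p.norm) :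
    ‖∏ p ∈ T, (1 - normTerm w p)‖ * ‖∏ p ∈ T, (1 - normTerm w.re p)‖ ≤ 1 := by
  rw [norm_prod, norm_prod, ← Finset.prod_mul_distrib]
  refine Finset.prod_le_one (fun p _ ↦ by positivity) fun p hp ↦ ?_
  have h1 : (1 : ℝ) < p.norm := by exact_mod_cast hT p hp
  set q : ℝ := (p.norm : ℝ) ^ (-w.re) with hq
  have hq0 : 0 ≤ q := Real.rpow_nonneg (by linarith) _
  have hq1 : q ≤ 1 := Real.rpow_le_one_of_one_le_of_nonpos h1.le (by linarith)
  have ha : ‖1 - normTerm w p‖ ≤ 1 + q := by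
    refine (norm_sub_le _ _).trans ?_
    rw [norm_one, norm_normTerm (by linarith)]
  have hb : ‖1 - normTerm (w.re : ℂ) p‖ = 1 - q := by
    rw [normTerm_ofReal, ← ofReal_one, ← ofReal_sub, norm_real, Real.norm_of_nonneg (by linarith)]
  rw [hb]
  nlinarith

/-- A lower bound in the half-plane of absolute convergence: an Euler factor at `w` times the one
at `Re w` has norm at least `1`. -/
theorem exists_le_norm_zeta_mul : ∃ C : ℝ, 0 < C ∧ ∀ w : ℂ, 1 < w.re →
    C ≤ ‖zeta w‖ * ‖zeta w.re‖ := by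
  obtain ⟨S, c, hc, hS, hlim⟩ := exists_tendsto_prod_mul_zeta
  refine ⟨c * c, mul_pos hc hc, fun w hw ↦ ?_⟩
  have h := ((hlim w hw).norm).mul ((hlim w.re (by simpa using hw)).norm)
  rw [norm_real, Real.norm_of_nonneg hc.le] at h
  refine le_of_tendsto h (Eventually.of_forall fun B ↦ ?_)
  simp only [norm_mul]
  have := norm_prod_mul_norm_prod_le_one hw (S B) (hS B)
  calc _ = (‖∏ p ∈ S B, (1 - normTerm w p)‖ * ‖∏ p ∈ S B, (1 - normTerm w.re p)‖)
        * (‖zeta w‖ * ‖zeta w.re‖) := by ring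
    _ ≤ 1 * (‖zeta w‖ * ‖zeta w.re‖) := by gcongr
    _ = _ := one_mul _

theorem zeta_ne_zero {w : ℂ} (hw : 1 < w.re) : zeta w ≠ 0 := by
  obtain ⟨C, hC, h⟩ := exists_le_norm_zeta_mul
  intro h0
  have := h w hw
  rw [h0, norm_zero, zero_mul] at this
  linarith

/-- The function `q ↦ ‖1 - q u‖ / (1 - q)` is increasing on `[0, 1)` for each unit vector `u`. -/
theorem norm_one_sub_mul_le {q r : ℝ} {u : ℂ} (hu : ‖u‖ = 1) (hr : 0 ≤ r) (hrq : r ≤ q)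
    (hq : q ≤ 1) : ‖1 - r * u‖ * (1 - q) ≤ ‖1 - q * u‖ * (1 - r) := by
  have hsq (t : ℝ) : ‖1 - t * u‖ ^ 2 = (1 - t) ^ 2 + 2 * t * (1 - u.re) := by
    have h2 : u.re * u.re + u.im * u.im = 1 := by
      rw [← normSq_apply, normSq_eq_norm_sq, hu, one_pow]
    rw [← normSq_eq_norm_sq, normSq_apply]
    simp
    linear_combination t ^ 2 * h2
  have hre : u.re ≤ 1 := hu ▸ re_le_norm u
  refine le_of_sq_le_sq ?_ (mul_nonneg (norm_nonneg _) (by linarith))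
  rw [mul_pow, mul_pow, hsq, hsq]
  have : 0 ≤ (1 - u.re) * ((q - r) * (1 - q * r)) := by
    refine mul_nonneg (by linarith) (mul_nonneg (by linarith) ?_)
    nlinarith
  nlinarith

theorem norm_one_sub_normTerm_mul_le {x₁ x₂ y : ℝ} (hx : 0 < x₁) (hx' : x₁ ≤ x₂)
    {p : GaussianInt} (hp : 1 < p.norm) :
    ‖1 - normTerm ⟨x₂, y⟩ p‖ * ‖1 - normTerm x₁ p‖
      ≤ ‖1 - normTerm ⟨x₁, y⟩ p‖ * ‖1 - normTerm x₂ p‖ := by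
  have h1 : (1 : ℝ) < p.norm := by exact_mod_cast hp
  have h0 : ((p.norm : ℝ) : ℂ) ≠ 0 := ofReal_ne_zero.mpr (by linarith)
  set u : ℂ := ((p.norm : ℝ) : ℂ) ^ (-(y * I)) with hu
  have hun : ‖u‖ = 1 := by
    rw [hu, norm_cpow_eq_rpow_re_of_pos (by linarith)]
    simp
  have hfac (x : ℝ) : normTerm ⟨x, y⟩ p = (((p.norm : ℝ) ^ (-x) : ℝ) : ℂ) * u := by
    rw [← normTerm_ofReal, normTerm, normTerm, hu, ← cpow_add _ _ h0]
    congr 1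
    apply Complex.ext <;> simp
  have hle (x : ℝ) (hx : 0 < x) : (p.norm : ℝ) ^ (-x) ≤ 1 :=
    Real.rpow_le_one_of_one_le_of_nonpos h1.le (by linarith)
  have hreal (x : ℝ) (hx : 0 < x) : ‖1 - normTerm (x : ℂ) p‖ = 1 - (p.norm : ℝ) ^ (-x) := by
    rw [normTerm_ofReal, ← ofReal_one, ← ofReal_sub, norm_real,
      Real.norm_of_nonneg (by linarith [hle x hx])]
  rw [hfac, hfac, hreal x₁ hx, hreal x₂ (by linarith)]
  exact norm_one_sub_mul_le hun (Real.rpow_nonneg (by linarith) _)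
    (Real.rpow_le_rpow_of_exponent_le h1.le (by linarith)) (hle x₁ hx)

/-- `‖ζ(Δ, x + iy)‖ / ‖ζ(Δ, x)‖` is increasing in `x > 1`, as every Euler factor is. -/
theorem norm_zeta_mul_le {x₁ x₂ : ℝ} (hx : 1 < x₁) (hx' : x₁ ≤ x₂) (y : ℝ) :
    ‖zeta ⟨x₁, y⟩‖ * ‖zeta x₂‖ ≤ ‖zeta ⟨x₂, y⟩‖ * ‖zeta x₁‖ := by
  obtain ⟨S, c, hc, hS, hlim⟩ := exists_tendsto_prod_mul_zeta
  have hx2 : 1 < x₂ := by linarith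
  have hl := (((hlim ⟨x₂, y⟩ hx2).norm).mul ((hlim x₁ (by simpa using hx)).norm)).mul_const
    (‖zeta ⟨x₁, y⟩‖ * ‖zeta x₂‖)
  have hr := (((hlim ⟨x₁, y⟩ hx).norm).mul ((hlim x₂ (by simpa using hx2)).norm)).mul_const
    (‖zeta ⟨x₂, y⟩‖ * ‖zeta x₁‖)
  have hc' : 0 < ‖(c : ℂ)‖ := by rw [norm_real, Real.norm_of_nonneg hc.le]; exact hc
  refine le_of_mul_le_mul_left (le_of_tendsto_of_tendsto hl hr (Eventually.of_forall fun B ↦ ?_))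
    (mul_pos hc' hc')
  have hprod : ‖∏ p ∈ S B, (1 - normTerm ⟨x₂, y⟩ p)‖ * ‖∏ p ∈ S B, (1 - normTerm x₁ p)‖
      ≤ ‖∏ p ∈ S B, (1 - normTerm ⟨x₁, y⟩ p)‖ * ‖∏ p ∈ S B, (1 - normTerm x₂ p)‖ := by
    simp only [norm_prod, ← Finset.prod_mul_distrib]
    exact Finset.prod_le_prod (fun p _ ↦ by positivity) fun p hp ↦
      norm_one_sub_normTerm_mul_le (by linarith) hx' (hS B p hp)
  simp only [norm_mul]
  calc _ = (‖∏ p ∈ S B, (1 - normTerm ⟨x₂, y⟩ p)‖ * ‖∏ p ∈ S B, (1 - normTerm x₁ p)‖)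
        * (‖zeta ⟨x₁, y⟩‖ * ‖zeta ⟨x₂, y⟩‖ * ‖zeta x₁‖ * ‖zeta x₂‖) := by ring
    _ ≤ (‖∏ p ∈ S B, (1 - normTerm ⟨x₁, y⟩ p)‖ * ‖∏ p ∈ S B, (1 - normTerm x₂ p)‖)
        * (‖zeta ⟨x₁, y⟩‖ * ‖zeta ⟨x₂, y⟩‖ * ‖zeta x₁‖ * ‖zeta x₂‖) := by gcongr
    _ = _ := by ring

theorem zeta_ofReal {x : ℝ} (hx : 1 < x) :
    zeta x = ((∑' z : GaussianInt, (z.norm : ℝ) ^ (-x) : ℝ) : ℂ) := by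
  rw [← (hasSum_normTerm (by simpa using hx)).tsum_eq, ofReal_tsum]
  exact tsum_congr fun z ↦ normTerm_ofReal x z

theorem norm_zeta_ofReal {x : ℝ} (hx : 1 < x) :
    ‖zeta x‖ = ∑' z : GaussianInt, (z.norm : ℝ) ^ (-x) := by
  rw [zeta_ofReal hx, norm_real, Real.norm_of_nonneg]
  exact tsum_nonneg fun z ↦ Real.rpow_nonneg (by exact_mod_cast GaussianInt.norm_nonneg z) _

theorem norm_zeta_antitone {x₁ x₂ : ℝ} (hx : 1 < x₁) (hx' : x₁ ≤ x₂) :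
    ‖zeta x₂‖ ≤ ‖zeta x₁‖ := by
  rw [norm_zeta_ofReal hx, norm_zeta_ofReal (hx.trans_le hx')]
  refine (summable_norm_rpow (hx.trans_le hx')).tsum_le_tsum (fun z ↦ ?_) (summable_norm_rpow hx)
  rcases eq_or_ne z 0 with rfl | hz
  · have h (x : ℝ) (hx : 1 < x) : ((0 : GaussianInt).norm : ℝ) ^ (-x) = 0 := by
      rw [Zsqrtd.norm_zero, Int.cast_zero, Real.zero_rpow (by linarith)]
    rw [h x₁ hx, h x₂ (hx.trans_le hx')]
  · have : 0 < z.norm := GaussianInt.norm_pos.mpr hz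
    exact Real.rpow_le_rpow_of_exponent_le (by exact_mod_cast this) (by linarith)

theorem one_le_norm_zeta_ofReal {x : ℝ} (hx : 1 < x) : 1 ≤ ‖zeta x‖ := by
  rw [norm_zeta_ofReal hx]
  refine le_trans (le_of_eq ?_) ((summable_norm_rpow hx).le_tsum 1 fun z _ ↦
    Real.rpow_nonneg (by exact_mod_cast GaussianInt.norm_nonneg z) _)
  simp

/-! ### The Gamma function on vertical lines -/

/-- `‖u + iy‖ / u` is decreasing in `u > 0`. -/
theorem norm_mk_mul_le {u v y : ℝ} (hu : 0 < u) (huv : u ≤ v) :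
    ‖(⟨v, y⟩ : ℂ)‖ * u ≤ ‖(⟨u, y⟩ : ℂ)‖ * v := by
  refine le_of_sq_le_sq ?_ (mul_nonneg (norm_nonneg _) (by linarith))
  rw [mul_pow, mul_pow, ← normSq_eq_norm_sq, ← normSq_eq_norm_sq, normSq_mk, normSq_mk]
  nlinarith [mul_le_mul_of_nonneg_left (pow_le_pow_left₀ hu.le huv 2) (sq_nonneg y)]

theorem norm_GammaSeq {w : ℂ} (hw : 0 < w.re) (n : ℕ) :
    ‖GammaSeq w n‖ = (n : ℝ) ^ w.re * n.factorial / ∏ j ∈ Finset.range (n + 1), ‖w + j‖ := by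
  rw [GammaSeq, norm_div, norm_mul, norm_natCast_cpow_of_re_ne_zero n hw.ne', norm_prod,
    norm_natCast]

/-- `‖Γ(x + iy)‖ / Γ(x)` is increasing in `x > 0`, as every factor `(x + j) / ‖x + j + iy‖` of
Euler's product is. -/
theorem norm_Gamma_mul_le {x₁ x₂ : ℝ} (hx : 0 < x₁) (hx' : x₁ ≤ x₂) (y : ℝ) :
    ‖Gamma ⟨x₁, y⟩‖ * ‖Gamma x₂‖ ≤ ‖Gamma ⟨x₂, y⟩‖ * ‖Gamma x₁‖ := by
  have hx2 : 0 < x₂ := by linarith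
  refine le_of_tendsto_of_tendsto
    ((GammaSeq_tendsto_Gamma ⟨x₁, y⟩).norm.mul (GammaSeq_tendsto_Gamma x₂).norm)
    ((GammaSeq_tendsto_Gamma ⟨x₂, y⟩).norm.mul (GammaSeq_tendsto_Gamma x₁).norm) ?_
  refine Eventually.of_forall fun n ↦ ?_
  beta_reduce
  rw [norm_GammaSeq (w := ⟨x₁, y⟩) hx, norm_GammaSeq (w := ⟨x₂, y⟩) hx2,
    norm_GammaSeq (w := x₁) (by simpa using hx), norm_GammaSeq (w := x₂) (by simpa using hx2)]
  have hpos (x y : ℝ) (hx : 0 < x) : 0 < ∏ j ∈ Finset.range (n + 1), ‖(⟨x, y⟩ : ℂ) + j‖ := by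
    refine Finset.prod_pos fun j _ ↦ norm_pos_iff.mpr fun h ↦ ?_
    have := congrArg re h
    simp at this
    have hj : (0 : ℝ) ≤ j := j.cast_nonneg
    linarith
  have hprod : (∏ j ∈ Finset.range (n + 1), ‖(⟨x₂, y⟩ : ℂ) + j‖)
        * ∏ j ∈ Finset.range (n + 1), ‖(x₁ : ℂ) + j‖
      ≤ (∏ j ∈ Finset.range (n + 1), ‖(⟨x₁, y⟩ : ℂ) + j‖)
        * ∏ j ∈ Finset.range (n + 1), ‖(x₂ : ℂ) + j‖ := by
    rw [← Finset.prod_mul_distrib, ← Finset.prod_mul_distrib]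
    refine Finset.prod_le_prod (fun j _ ↦ by positivity) fun j _ ↦ ?_
    have hj : (0 : ℝ) ≤ j := j.cast_nonneg
    have e1 (x : ℝ) : (⟨x, y⟩ : ℂ) + j = ⟨x + j, y⟩ := by apply Complex.ext <;> simp
    have e2 (x : ℝ) (hx : 0 < x) : ‖(x : ℂ) + j‖ = x + j := by
      rw [← ofReal_natCast, ← ofReal_add, norm_real, Real.norm_of_nonneg (by linarith)]
    rw [e1, e1, e2 x₁ hx, e2 x₂ hx2]
    exact norm_mk_mul_le (by linarith) (by linarith)
  have e3 (x : ℝ) : (x : ℂ) = ⟨x, 0⟩ := rfl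
  rw [div_mul_div_comm, div_mul_div_comm, div_le_div_iff₀ (mul_pos (hpos _ _ hx)
    (by rw [e3]; exact hpos _ _ hx2)) (mul_pos (hpos _ _ hx2) (by rw [e3]; exact hpos _ _ hx))]
  simp only [ofReal_re]
  refine le_trans (le_of_eq ?_) ((mul_le_mul_of_nonneg_left hprod
    (show 0 ≤ (n : ℝ) ^ x₁ * n.factorial * ((n : ℝ) ^ x₂ * n.factorial) by positivity)).trans
    (le_of_eq ?_)) <;> ring

/-- A consequence of the reflection formula, which gives `‖Γ(1 + iy)‖² = π y / sinh (π y)`. -/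
theorem norm_Gamma_one_add_mul_I {y : ℝ} (hy : 1 ≤ |y|) :
    1 ≤ Real.exp (Real.pi * |y|) * ‖Gamma ⟨1, y⟩‖ ^ 2 := by
  have hy0 : y ≠ 0 := by rintro rfl; simp at hy; linarith
  have hz0 : (y * I : ℂ) ≠ 0 := by simp [hy0]
  have e : (⟨1, y⟩ : ℂ) = y * I + 1 := by apply Complex.ext <;> simp
  have hconj : ‖Gamma (1 - y * I)‖ = ‖Gamma (⟨1, y⟩ : ℂ)‖ := by
    rw [← norm_conj (Gamma (⟨1, y⟩ : ℂ)), ← Gamma_conj]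
    congr 2
    apply Complex.ext <;> simp
  have h := congrArg norm (Gamma_mul_Gamma_one_sub (y * I))
  have h2 : Gamma (⟨1, y⟩ : ℂ) = y * I * Gamma (y * I) := by rw [e, Gamma_add_one _ hz0]
  have hsin : ‖sin (Real.pi * (y * I))‖ ≤ Real.exp (Real.pi * |y|) := by
    rw [show (Real.pi * (y * I) : ℂ) = ((Real.pi * y : ℝ) : ℂ) * I by push_cast; ring, sin_mul_I,
      norm_mul, norm_I, mul_one, ← ofReal_sinh, norm_real, Real.norm_eq_abs, Real.abs_sinh,
      Real.sinh_eq, abs_mul, abs_of_pos Real.pi_pos]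
    have := Real.exp_pos (Real.pi * |y|)
    have := Real.exp_pos (-(Real.pi * |y|))
    linarith
  have hs0 : 0 < ‖sin (Real.pi * (y * I))‖ := by
    refine norm_pos_iff.mpr fun h0 ↦ ?_
    rw [h0, div_zero, norm_zero, norm_mul, mul_eq_zero, hconj, norm_eq_zero, norm_eq_zero] at h
    have hne : Gamma (⟨1, y⟩ : ℂ) ≠ 0 := Gamma_ne_zero_of_re_pos (by simp)
    rcases h with h | h
    · exact hne (by rw [h2, h, mul_zero])
    · exact hne h
  have hkey : ‖Gamma (⟨1, y⟩ : ℂ)‖ ^ 2 * ‖sin (Real.pi * (y * I))‖ = |y| * Real.pi := by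
    rw [norm_div, norm_mul, hconj, eq_div_iff hs0.ne', norm_real,
      Real.norm_of_nonneg Real.pi_pos.le] at h
    have h3 := congrArg norm h2
    rw [norm_mul, norm_mul, norm_I, mul_one, norm_real, Real.norm_eq_abs] at h3
    rw [sq]
    nth_rewrite 1 [h3]
    linear_combination |y| * h
  calc (1 : ℝ) ≤ |y| * Real.pi := by nlinarith [Real.pi_gt_three]
    _ = ‖Gamma (⟨1, y⟩ : ℂ)‖ ^ 2 * ‖sin (Real.pi * (y * I))‖ := hkey.symm
    _ ≤ ‖Gamma (⟨1, y⟩ : ℂ)‖ ^ 2 * Real.exp (Real.pi * |y|) := by gcongr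
    _ = _ := mul_comm _ _

/-- Exponential lower bound for the Gamma function on vertical lines. -/
theorem norm_Gamma_ofReal_le {x y : ℝ} (hx : 1 ≤ x) (hy : 1 ≤ |y|) :
    ‖Gamma x‖ ≤ Real.exp (Real.pi * |y|) * ‖Gamma ⟨x, y⟩‖ := by
  have h1 := norm_Gamma_mul_le one_pos hx y
  rw [ofReal_one, Gamma_one, norm_one, mul_one] at h1
  have h2 := norm_Gamma_one_add_mul_I hy
  have hE : 1 ≤ Real.exp (Real.pi * |y|) := Real.one_le_exp (by positivity)
  have h3 : 1 ≤ Real.exp (Real.pi * |y|) * ‖Gamma ⟨1, y⟩‖ := by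
    by_contra! h
    have hg : ‖Gamma (⟨1, y⟩ : ℂ)‖ ≤ 1 := by nlinarith [norm_nonneg (Gamma (⟨1, y⟩ : ℂ))]
    nlinarith [norm_nonneg (Gamma (⟨1, y⟩ : ℂ))]
  calc ‖Gamma x‖ = 1 * ‖Gamma x‖ := (one_mul _).symm
    _ ≤ (Real.exp (Real.pi * |y|) * ‖Gamma ⟨1, y⟩‖) * ‖Gamma x‖ := by gcongr
    _ = Real.exp (Real.pi * |y|) * (‖Gamma ⟨1, y⟩‖ * ‖Gamma x‖) := by ring
    _ ≤ _ := by gcongr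

/-! ### The completed zeta function -/

/-- The continuation of `ζ(Δ, ·)` in terms of the entire Mellin transform `Λ₀`. -/
theorem zeta_eq {w : ℂ} (hw : w ≠ 1) :
    zeta w = (Real.pi : ℂ) ^ w * ((Gamma w)⁻¹ * thetaPair.Λ₀ w - (Gamma (w + 1))⁻¹
      - (Gamma w)⁻¹ * (1 - w)⁻¹) := by
  have hpi : (Real.pi : ℂ) ≠ 0 := by simp [Real.pi_ne_zero]
  have hW : IsSpectralZeta fun s ↦ (Real.pi : ℂ) ^ s * ((Gamma s)⁻¹ * thetaPair.Λ₀ s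
      - (Gamma (s + 1))⁻¹ - (Gamma s)⁻¹ * (1 - s)⁻¹) := by
    refine ⟨fun s hs ↦ ?_, fun s hs ↦ ?_⟩
    · have h1 : DifferentiableAt ℂ (fun s : ℂ ↦ (Gamma s)⁻¹) s := differentiable_one_div_Gamma s
      have h2 : DifferentiableAt ℂ (fun s : ℂ ↦ (Gamma (s + 1))⁻¹) s :=
        (differentiable_one_div_Gamma.comp (differentiable_id.add_const (1 : ℂ))) s
      have h3 : DifferentiableAt ℂ thetaPair.Λ₀ s := thetaPair.differentiable_Λ₀ s
      have h4 : DifferentiableAt ℂ (fun s : ℂ ↦ (1 - s)⁻¹) s :=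
        DifferentiableAt.inv (by fun_prop) (sub_ne_zero.mpr (Ne.symm hs))
      have h5 : DifferentiableAt ℂ (fun s : ℂ ↦ (Real.pi : ℂ) ^ s) s :=
        DifferentiableAt.const_cpow differentiableAt_id (Or.inl hpi)
      exact (h5.mul (((h1.mul h3).sub h2).sub (h1.mul h4))).differentiableWithinAt
    · have h := hasSum_thetaPair hs
      have hs0 : s ≠ 0 := by rintro rfl; simp at hs; linarith
      convert h using 1
      beta_reduce
      rw [WeakFEPair.Λ, Gamma_add_one s hs0]
      simp only [thetaPair, smul_eq_mul, mul_one, ofReal_one, mul_inv]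
      ring
  exact isSpectralZeta_zeta.eqOn hW hw

theorem Gamma_mul_zeta {w : ℂ} (hw0 : w ≠ 0) (hw1 : w ≠ 1) (hG : Gamma w ≠ 0) :
    Gamma w * zeta w = (Real.pi : ℂ) ^ w * thetaPair.Λ w := by
  rw [zeta_eq hw1, WeakFEPair.Λ, Gamma_add_one w hw0]
  simp only [thetaPair, smul_eq_mul, mul_one, ofReal_one]
  have := sub_ne_zero.mpr hw1.symm
  field_simp

/-- The entire function `w (w - 1) π^(-w) Γ(w) ζ(Δ, w)`, written with the entire part `Λ₀` of the
completed zeta function `Λ` so that the values at the removable points `0` and `1` are right. -/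
noncomputable def xi (w : ℂ) : ℂ := w * (w - 1) * thetaPair.Λ₀ w + 1

theorem xi_eq {w : ℂ} (hw0 : w ≠ 0) (hw1 : w ≠ 1) : xi w = w * (w - 1) * thetaPair.Λ w := by
  rw [xi, WeakFEPair.Λ]
  simp only [thetaPair, smul_eq_mul, mul_one, ofReal_one]
  have := sub_ne_zero.mpr hw1.symm
  field_simp
  ring

theorem differentiable_xi : Differentiable ℂ xi :=
  (((differentiable_id.mul (differentiable_id.sub_const 1)).mul
    thetaPair.differentiable_Λ₀).add_const 1)

theorem symm_thetaPair : thetaPair.symm = thetaPair := by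
  simp [WeakFEPair.symm, thetaPair]

theorem Λ_one_sub (w : ℂ) : thetaPair.Λ (1 - w) = thetaPair.Λ w := by
  have h := thetaPair.functional_equation w
  rw [symm_thetaPair] at h
  simpa [thetaPair] using h

theorem xi_one_sub (w : ℂ) : xi (1 - w) = xi w := by
  have h := thetaPair.functional_equation₀ w
  rw [symm_thetaPair, show (thetaPair.k : ℂ) = 1 from ofReal_one,
    show thetaPair.ε = 1 from rfl, one_smul] at h
  rw [xi, xi, h]
  ring

theorem ne_zero_of_one_lt_re {w : ℂ} (hw : 1 < w.re) : w ≠ 0 := by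
  rintro rfl; simp at hw; linarith

theorem ne_one_of_one_lt_re {w : ℂ} (hw : 1 < w.re) : w ≠ 1 := by
  rintro rfl; simp at hw

theorem norm_Gamma_mul_zeta {w : ℂ} (hw0 : w ≠ 0) (hw1 : w ≠ 1) (hG : Gamma w ≠ 0) :
    ‖Gamma w‖ * ‖zeta w‖ = Real.pi ^ w.re * ‖thetaPair.Λ w‖ := by
  rw [← norm_mul, Gamma_mul_zeta hw0 hw1 hG, norm_mul, norm_cpow_eq_rpow_re_of_pos Real.pi_pos]

theorem Λ_ne_zero {w : ℂ} (hw : 1 < w.re) : thetaPair.Λ w ≠ 0 := by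
  intro h
  have hG : Gamma w ≠ 0 := Gamma_ne_zero_of_re_pos (by linarith)
  have := Gamma_mul_zeta (ne_zero_of_one_lt_re hw) (ne_one_of_one_lt_re hw) hG
  rw [h, mul_zero] at this
  exact mul_ne_zero hG (zeta_ne_zero hw) this

theorem norm_xi {w : ℂ} (hw : 1 < w.re) : Real.pi ^ w.re * ‖xi w‖
    = ‖w‖ * ‖w - 1‖ * (‖Gamma w‖ * ‖zeta w‖) := by
  have hw0 := ne_zero_of_one_lt_re hw
  have hw1 := ne_one_of_one_lt_re hw
  rw [norm_Gamma_mul_zeta hw0 hw1 (Gamma_ne_zero_of_re_pos (by linarith)), xi_eq hw0 hw1,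
    norm_mul, norm_mul]
  ring

theorem xi_ne_zero {w : ℂ} (hw : 1 < w.re) : xi w ≠ 0 := by
  have hw0 := ne_zero_of_one_lt_re hw
  have hw1 := ne_one_of_one_lt_re hw
  rw [xi_eq hw0 hw1]
  exact mul_ne_zero (mul_ne_zero hw0 (sub_ne_zero.mpr hw1)) (Λ_ne_zero hw)

theorem zeta_conj {w : ℂ} (hw : w ≠ 1) :
    zeta ((starRingEnd ℂ) w) = (starRingEnd ℂ) (zeta w) := by
  have hW : IsSpectralZeta fun s ↦ (starRingEnd ℂ) (zeta ((starRingEnd ℂ) s)) := by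
    refine ⟨fun s hs ↦ ?_, fun s hs ↦ ?_⟩
    · have hs' : (starRingEnd ℂ) s ∈ ({1}ᶜ : Set ℂ) := by
        intro h
        apply hs
        have h : (starRingEnd ℂ) s = 1 := h
        rw [mem_singleton_iff, ← conj_conj s, h, map_one]
      have h := (isSpectralZeta_zeta.1.differentiableAt (isOpen_compl_singleton.mem_nhds hs'))
      have h2 := h.conj_conj
      rw [conj_conj] at h2
      exact h2.differentiableWithinAt
    · have h := (isSpectralZeta_zeta.2 ((starRingEnd ℂ) s) (by simpa using hs))
      have h := Complex.hasSum_conj'.mpr h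
      refine h.congr_fun fun k ↦ ?_
      have hk : (0 : ℝ) ≤ ((k.1.1 ^ 2 + k.1.2 ^ 2 : ℤ) : ℝ) := by push_cast; positivity
      have harg : arg (((k.1.1 ^ 2 + k.1.2 ^ 2 : ℤ) : ℝ) : ℂ) ≠ Real.pi := by
        rw [arg_ofReal_of_nonneg hk]
        exact Real.pi_pos.ne
      rw [eigTerm, eigTerm, ← ofReal_intCast, ← map_neg, cpow_conj _ _ harg, conj_ofReal,
        conj_conj]
  have h := isSpectralZeta_zeta.eqOn hW hw
  beta_reduce at h
  rw [h, conj_conj]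

theorem norm_zeta_conj {w : ℂ} (hw : w ≠ 1) : ‖zeta ((starRingEnd ℂ) w)‖ = ‖zeta w‖ := by
  rw [zeta_conj hw, norm_conj]

theorem norm_xi_conj {w : ℂ} (hw : 1 < w.re) : ‖xi ((starRingEnd ℂ) w)‖ = ‖xi w‖ := by
  have h := norm_xi (w := (starRingEnd ℂ) w) (by simpa using hw)
  rw [norm_zeta_conj (ne_one_of_one_lt_re hw), Gamma_conj, norm_conj, norm_conj,
    show (starRingEnd ℂ) w - 1 = (starRingEnd ℂ) (w - 1) by simp, norm_conj, conj_re,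
    ← norm_xi hw] at h
  exact mul_left_cancel₀ (Real.rpow_pos_of_pos Real.pi_pos _).ne' h

/-- The entire part of the completed zeta function, being the Mellin transform of a function of
rapid decay at `0` and `∞`, is bounded in vertical strips. -/
theorem exists_norm_Λ₀_le (a b : ℝ) :
    ∃ M : ℝ, ∀ w : ℂ, a ≤ w.re → w.re ≤ b → ‖thetaPair.Λ₀ w‖ ≤ M := by
  have hconv (s : ℂ) : MellinConvergent thetaPair.f_modif s :=
    (thetaPair.isStrongFEPair_toStrongFEPair.hasMellin s).1
  have ha := (hconv a).norm
  have hb := (hconv b).norm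
  refine ⟨∫ t in Ioi (0 : ℝ), (‖(t : ℂ) ^ ((a : ℂ) - 1) • thetaPair.f_modif t‖
    + ‖(t : ℂ) ^ ((b : ℂ) - 1) • thetaPair.f_modif t‖), fun w hwa hwb ↦ ?_⟩
  rw [WeakFEPair.Λ₀, mellin]
  refine MeasureTheory.norm_integral_le_of_norm_le (ha.add hb) ?_
  refine (MeasureTheory.ae_restrict_iff' measurableSet_Ioi).mpr (Eventually.of_forall fun t ht ↦ ?_)
  have ht : 0 < t := ht
  simp only [norm_smul, norm_cpow_eq_rpow_re_of_pos ht, sub_re, ofReal_re, one_re, ← add_mul]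
  refine mul_le_mul_of_nonneg_right ?_ (norm_nonneg _)
  rcases le_total t 1 with h | h
  · exact (Real.rpow_le_rpow_of_exponent_ge ht h (by linarith)).trans
      (le_add_of_nonneg_right (by positivity))
  · exact (Real.rpow_le_rpow_of_exponent_le h (by linarith)).trans
      (le_add_of_nonneg_left (by positivity))

/-! ### Horizontal monotonicity of the completed zeta function -/

theorem norm_mk_le {u v : ℝ} (hu : 0 ≤ u) (huv : u ≤ v) (y : ℝ) :
    ‖(⟨u, y⟩ : ℂ)‖ ≤ ‖(⟨v, y⟩ : ℂ)‖ := by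
  refine le_of_sq_le_sq ?_ (norm_nonneg _)
  rw [← normSq_eq_norm_sq, ← normSq_eq_norm_sq, normSq_mk, normSq_mk]
  nlinarith

theorem norm_Gamma_ofReal_mono {x y : ℝ} (hx : 2 ≤ x) (hxy : x ≤ y) :
    ‖Gamma x‖ ≤ ‖Gamma y‖ := by
  rw [Gamma_ofReal, Gamma_ofReal, norm_real, norm_real,
    Real.norm_of_nonneg (Real.Gamma_pos_of_pos (by linarith)).le,
    Real.norm_of_nonneg (Real.Gamma_pos_of_pos (by linarith)).le]
  exact Real.Gamma_strictMonoOn_Ici.monotoneOn hx (hx.trans hxy) hxy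

/-- Far to the right, the Gamma factor makes `‖xi‖` increase over any step longer than `1`. -/
theorem exists_norm_xi_sub_le {δ : ℝ} (hδ : 1 < δ) :
    ∃ R₀ : ℝ, ∀ R y : ℝ, R₀ ≤ R → ‖xi ⟨R - δ, y⟩‖ ≤ ‖xi ⟨R, y⟩‖ := by
  refine ⟨max (δ + 3) (1 + Real.pi ^ δ * ‖zeta (2 : ℝ)‖), fun R y hR ↦ ?_⟩
  have hR1 : δ + 3 ≤ R := (le_max_left _ _).trans hR
  have hR2 : 1 + Real.pi ^ δ * ‖zeta (2 : ℝ)‖ ≤ R := (le_max_right _ _).trans hR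
  have hpi (x : ℝ) : 0 < Real.pi ^ x := Real.rpow_pos_of_pos Real.pi_pos x
  have e1 := norm_xi (w := ⟨R - δ, y⟩) (by simp only; linarith)
  have e2 := norm_xi (w := ⟨R, y⟩) (by simp only; linarith)
  have es (x : ℝ) : (⟨x, y⟩ : ℂ) - 1 = ⟨x - 1, y⟩ := by apply Complex.ext <;> simp
  rw [es] at e1 e2
  simp only at e1 e2
  have h1 : ‖(⟨R - δ, y⟩ : ℂ)‖ ≤ ‖(⟨R, y⟩ : ℂ)‖ := norm_mk_le (by linarith) (by linarith) y
  have h2 : ‖(⟨R - δ - 1, y⟩ : ℂ)‖ ≤ ‖(⟨R - 1, y⟩ : ℂ)‖ :=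
    norm_mk_le (by linarith) (by linarith) y
  have hG : (R - 1) * ‖Gamma ⟨R - δ, y⟩‖ ≤ ‖Gamma ⟨R, y⟩‖ := by
    have h := norm_Gamma_mul_le (x₁ := R - δ) (x₂ := R) (by linarith) (by linarith) y
    have h' := norm_Gamma_ofReal_mono (x := R - δ) (y := R - 1) (by linarith) (by linarith)
    have h'' : ‖Gamma (R : ℂ)‖ = (R - 1) * ‖Gamma ((R - 1 : ℝ) : ℂ)‖ := by
      have hR0 : ((R - 1 : ℝ) : ℂ) ≠ 0 := ofReal_ne_zero.mpr (by linarith)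
      have := Gamma_add_one _ hR0
      rw [← ofReal_one, ← ofReal_add, sub_add_cancel] at this
      rw [this, norm_mul, norm_real, Real.norm_of_nonneg (by linarith)]
    have hpos : 0 < ‖Gamma ((R - 1 : ℝ) : ℂ)‖ := norm_pos_iff.mpr
      (Gamma_ne_zero_of_re_pos (by rw [ofReal_re]; linarith))
    refine le_of_mul_le_mul_right ?_ hpos
    calc _ = ‖Gamma ⟨R - δ, y⟩‖ * ‖Gamma (R : ℂ)‖ := by rw [h'']; ring
      _ ≤ ‖Gamma ⟨R, y⟩‖ * ‖Gamma ((R - δ : ℝ) : ℂ)‖ := h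
      _ ≤ _ := by gcongr
  have hZ : ‖zeta ⟨R - δ, y⟩‖ ≤ ‖zeta ⟨R, y⟩‖ * ‖zeta (2 : ℝ)‖ := by
    have h := norm_zeta_mul_le (x₁ := R - δ) (x₂ := R) (by linarith) (by linarith) y
    have h' := norm_zeta_antitone (x₁ := 2) (x₂ := R - δ) (by norm_num) (by linarith)
    have h'' := one_le_norm_zeta_ofReal (x := R) (by linarith)
    calc ‖zeta ⟨R - δ, y⟩‖ = ‖zeta ⟨R - δ, y⟩‖ * 1 := (mul_one _).symm
      _ ≤ ‖zeta ⟨R - δ, y⟩‖ * ‖zeta R‖ := by gcongr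
      _ ≤ _ := h
      _ ≤ _ := by gcongr
  rw [Real.rpow_sub Real.pi_pos] at e1
  have hRpos : 0 < R - 1 := by linarith
  refine le_of_mul_le_mul_left (le_of_mul_le_mul_left ?_ hRpos) (hpi R)
  calc (R - 1) * (Real.pi ^ R * ‖xi ⟨R - δ, y⟩‖)
      = Real.pi ^ δ * (R - 1) * (Real.pi ^ R / Real.pi ^ δ * ‖xi ⟨R - δ, y⟩‖) := by
        have := (hpi δ).ne'
        field_simp
    _ = Real.pi ^ δ * (‖(⟨R - δ, y⟩ : ℂ)‖ * ‖(⟨R - δ - 1, y⟩ : ℂ)‖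
          * (((R - 1) * ‖Gamma ⟨R - δ, y⟩‖) * ‖zeta ⟨R - δ, y⟩‖)) := by rw [e1]; ring
    _ ≤ Real.pi ^ δ * (‖(⟨R, y⟩ : ℂ)‖ * ‖(⟨R - 1, y⟩ : ℂ)‖
          * (‖Gamma ⟨R, y⟩‖ * (‖zeta ⟨R, y⟩‖ * ‖zeta (2 : ℝ)‖))) := by gcongr
    _ = (Real.pi ^ δ * ‖zeta (2 : ℝ)‖) * (Real.pi ^ R * ‖xi ⟨R, y⟩‖) := by rw [e2]; ring
    _ ≤ (R - 1) * (Real.pi ^ R * ‖xi ⟨R, y⟩‖) := by gcongr; linarith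

/-- The function `1 / xi` grows at most exponentially in vertical strips to the right of `1`. -/
theorem exists_one_le_mul_norm_xi {σ R : ℝ} (hσ : 1 < σ) :
    ∃ K : ℝ, 0 ≤ K ∧ ∀ w : ℂ, σ ≤ w.re → w.re ≤ R → 1 ≤ |w.im| →
      1 ≤ K * Real.exp (Real.pi * |w.im|) * ‖xi w‖ := by
  obtain ⟨C, hC, hz⟩ := exists_le_norm_zeta_mul
  rcases lt_or_ge R σ with hR | hR
  · exact ⟨0, le_rfl, fun w h1 h2 ↦ absurd (h1.trans h2) (not_le.mpr hR)⟩
  have hR0 : 0 < R := by linarith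
  refine ⟨Real.pi ^ R * R * ‖zeta σ‖ / C, by positivity, fun w h1 h2 hy ↦ ?_⟩
  have hre : 1 < w.re := hσ.trans_le h1
  have hpi : Real.pi ^ w.re ≤ Real.pi ^ R :=
    Real.rpow_le_rpow_of_exponent_le (by linarith [Real.pi_gt_three]) h2
  have hG : 1 ≤ R * (Real.exp (Real.pi * |w.im|) * ‖Gamma w‖) := by
    have h := norm_Gamma_ofReal_le (x := w.re) (y := w.im) hre.le hy
    have h0 : (w.re : ℂ) ≠ 0 := ofReal_ne_zero.mpr (by linarith)
    have h3 := Gamma_add_one _ h0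
    have h4 := norm_Gamma_ofReal_mono (x := 2) (y := w.re + 1) le_rfl (by linarith)
    rw [ofReal_add, ofReal_one, h3, norm_mul, norm_real, Real.norm_of_nonneg (by linarith),
      ofReal_ofNat, Gamma_ofNat_eq_factorial] at h4
    simp at h4
    calc (1 : ℝ) ≤ w.re * ‖Gamma w.re‖ := h4
      _ ≤ R * (Real.exp (Real.pi * |w.im|) * ‖Gamma w‖) := by gcongr
  have hZ : C ≤ ‖zeta w‖ * ‖zeta σ‖ := (hz w hre).trans
    (mul_le_mul_of_nonneg_left (norm_zeta_antitone hσ h1) (norm_nonneg _))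
  have hw : 1 ≤ ‖w‖ := hy.trans (abs_im_le_norm w)
  have hw' : 1 ≤ ‖w - 1‖ := hy.trans (by simpa using abs_im_le_norm (w - 1))
  rw [← mul_le_mul_iff_of_pos_right hC, one_mul]
  calc C = 1 * 1 * (1 * C) := by ring
    _ ≤ ‖w‖ * ‖w - 1‖ * ((R * (Real.exp (Real.pi * |w.im|) * ‖Gamma w‖))
          * (‖zeta w‖ * ‖zeta σ‖)) := by gcongr
    _ = R * ‖zeta σ‖ * Real.exp (Real.pi * |w.im|) * (Real.pi ^ w.re * ‖xi w‖) := by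
        rw [norm_xi hre]; ring
    _ ≤ R * ‖zeta σ‖ * Real.exp (Real.pi * |w.im|) * (Real.pi ^ R * ‖xi w‖) := by gcongr
    _ = _ := by field_simp

/-- A crude bound for `xi` in vertical strips, sufficient for the Phragmén–Lindelöf principle. -/
theorem exists_norm_xi_le_exp (a b : ℝ) : ∃ K : ℝ, 0 ≤ K ∧ ∀ w : ℂ, a ≤ w.re → w.re ≤ b →
    ‖xi w‖ ≤ K * Real.exp (2 * |w.im|) := by
  obtain ⟨M, hM⟩ := exists_norm_Λ₀_le a b
  set A : ℝ := |a| + |b| with hA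
  have hA0 : 0 ≤ A := by positivity
  refine ⟨(A + 2) ^ 2 * |M| + 1, by positivity, fun w h1 h2 ↦ ?_⟩
  have hexp : 1 + |w.im| ≤ Real.exp |w.im| := by linarith [Real.add_one_le_exp |w.im|]
  have hre : |w.re| ≤ A := abs_le.mpr
    ⟨by linarith [neg_abs_le a, abs_nonneg b], by linarith [le_abs_self b, abs_nonneg a]⟩
  have hw : ‖w‖ + 1 ≤ (A + 2) * Real.exp |w.im| := by
    have := norm_le_abs_re_add_abs_im w
    nlinarith [abs_nonneg w.im]
  have hw' : ‖w - 1‖ ≤ ‖w‖ + 1 := by simpa using norm_sub_le w 1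
  have hM' : ‖thetaPair.Λ₀ w‖ ≤ |M| := (hM w h1 h2).trans (le_abs_self M)
  have he : Real.exp (2 * |w.im|) = Real.exp |w.im| ^ 2 := by
    rw [← Real.exp_nat_mul]; norm_num
  have he1 : 1 ≤ Real.exp (2 * |w.im|) := Real.one_le_exp (by positivity)
  calc ‖xi w‖ ≤ ‖w * (w - 1) * thetaPair.Λ₀ w‖ + ‖(1 : ℂ)‖ := norm_add_le _ _
    _ = ‖w‖ * ‖w - 1‖ * ‖thetaPair.Λ₀ w‖ + 1 := by rw [norm_mul, norm_mul, norm_one]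
    _ ≤ ((A + 2) * Real.exp |w.im|) * ((A + 2) * Real.exp |w.im|) * |M| + 1 := by
        gcongr
        · linarith
        · linarith
    _ = (A + 2) ^ 2 * |M| * Real.exp (2 * |w.im|) + 1 := by rw [he]; ring
    _ ≤ _ := by nlinarith

/-- `‖xi (x + iy)‖` is non-decreasing in `x > 1`. Let `σ` be the midpoint of `x₁` and `x₂`. The
quotient `xi (2σ - w) / xi w` has modulus `1` on the line `Re w = σ` and modulus at most `1` far to
the right, so the Phragmén–Lindelöf principle bounds it by `1` at `w = x₂ + iy`. -/
theorem norm_xi_mono {x₁ x₂ : ℝ} (hx : 1 < x₁) (hx' : x₁ < x₂) (y : ℝ) :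
    ‖xi ⟨x₁, y⟩‖ ≤ ‖xi ⟨x₂, y⟩‖ := by
  obtain ⟨σ, hσ⟩ : ∃ σ : ℝ, 2 * σ = x₁ + x₂ := ⟨(x₁ + x₂) / 2, by ring⟩
  have hσ1 : 1 < σ := by linarith
  obtain ⟨R₀, hR₀⟩ := exists_norm_xi_sub_le (δ := 2 * σ - 1) (by linarith)
  set R : ℝ := max R₀ x₂ with hR
  have hσR : σ < R := lt_of_lt_of_le (by linarith) (le_max_right R₀ x₂)
  set F : ℂ → ℂ := fun w ↦ xi (2 * σ - w) / xi w with hF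
  have hne {w : ℂ} (hw : σ ≤ w.re) : xi w ≠ 0 := xi_ne_zero (hσ1.trans_le hw)
  have hdiff : DiffContOnCl ℂ F (re ⁻¹' Ioo σ R) := by
    refine DifferentiableOn.diffContOnCl fun w hw ↦ ?_
    have hw' : w ∈ re ⁻¹' Icc σ R := closure_minimal (preimage_mono Ioo_subset_Icc_self)
      (isClosed_Icc.preimage continuous_re) hw
    refine (DifferentiableAt.div ?_ (differentiable_xi w) (hne hw'.1)).differentiableWithinAt
    exact (differentiable_xi _).comp w ((differentiableAt_const _).sub differentiableAt_id)
  have hgrowth : ∃ c < Real.pi / (R - σ), ∃ B,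
      F =O[comap (_root_.abs ∘ im) atTop ⊓ 𝓟 (re ⁻¹' Ioo σ R)]
        fun z ↦ Real.exp (B * Real.exp (c * |z.im|)) := by
    obtain ⟨K₁, hK₁, h1⟩ := exists_norm_xi_le_exp (2 * σ - R) σ
    obtain ⟨K₂, hK₂, h2⟩ := exists_one_le_mul_norm_xi (R := R) hσ1
    have hc : 0 < Real.pi / (R - σ) := div_pos Real.pi_pos (by linarith)
    set c : ℝ := Real.pi / (R - σ) / 2 with hcdef
    have hc0 : 0 < c := half_pos hc
    refine ⟨c, half_lt_self hc, (Real.pi + 2) / c, IsBigO.of_bound (K₁ * K₂) ?_⟩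
    have hlarge : ∀ᶠ w : ℂ in comap (_root_.abs ∘ im) atTop, 1 ≤ |w.im| :=
      tendsto_comap.eventually (eventually_ge_atTop (1 : ℝ))
    filter_upwards [hlarge.filter_mono inf_le_left, mem_inf_of_right (mem_principal_self _)]
      with w hw hwre
    have hw1 : σ < w.re := hwre.1
    have hw2 : w.re < R := hwre.2
    have b1 := h1 (2 * σ - w) (by simp; linarith) (by simp; linarith)
    have b2 := h2 w hw1.le hw2.le hw
    have him : (2 * (σ : ℂ) - w).im = -w.im := by simp
    rw [him, abs_neg] at b1
    have hpos : 0 < ‖xi w‖ := norm_pos_iff.mpr (hne hw1.le)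
    have hexp : (Real.pi + 2) * |w.im| ≤ (Real.pi + 2) / c * Real.exp (c * |w.im|) := by
      have h := Real.add_one_le_exp (c * |w.im|)
      have h' : |w.im| ≤ Real.exp (c * |w.im|) / c := by
        rw [le_div_iff₀ hc0]; linarith
      calc (Real.pi + 2) * |w.im| ≤ (Real.pi + 2) * (Real.exp (c * |w.im|) / c) := by
            have := Real.pi_pos
            gcongr
        _ = _ := by ring
    rw [Real.norm_of_nonneg (Real.exp_pos _).le, hF, norm_div, div_le_iff₀ hpos]
    calc ‖xi (2 * σ - w)‖ ≤ K₁ * Real.exp (2 * |w.im|) * 1 := by linarith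
      _ ≤ K₁ * Real.exp (2 * |w.im|) * (K₂ * Real.exp (Real.pi * |w.im|) * ‖xi w‖) := by gcongr
      _ = K₁ * K₂ * Real.exp ((Real.pi + 2) * |w.im|) * ‖xi w‖ := by
          rw [add_mul, Real.exp_add]; ring
      _ ≤ _ := by gcongr
  -- On the left edge `2σ - w` is the conjugate of `w`.
  have hleft (w : ℂ) (hw : w.re = σ) : ‖F w‖ ≤ 1 := by
    have e : 2 * (σ : ℂ) - w = (starRingEnd ℂ) w := by
      apply Complex.ext
      · simp; linarith
      · simp
    rw [hF, norm_div, e, norm_xi_conj (by linarith)]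
    exact div_self_le_one _
  -- On the right edge the functional equation turns `2σ - w` into `w - (2σ - 1)`.
  have hright (w : ℂ) (hw : w.re = R) : ‖F w‖ ≤ 1 := by
    have e : 1 - (2 * (σ : ℂ) - w) = ⟨R - (2 * σ - 1), w.im⟩ := by
      apply Complex.ext
      · simp; linarith
      · simp
    have e' : w = ⟨R, w.im⟩ := by apply Complex.ext <;> simp [hw]
    rw [hF, norm_div, ← xi_one_sub, e]
    refine div_le_one_of_le₀ ?_ (norm_nonneg _)
    conv_rhs => rw [e']
    exact hR₀ R w.im (le_max_left _ _)
  have hmain := PhragmenLindelof.vertical_strip (z := ⟨x₂, y⟩) hdiff hgrowth hleft hright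
    (by simp only; linarith) (le_max_right R₀ x₂)
  have e : 2 * (σ : ℂ) - ⟨x₂, y⟩ = (starRingEnd ℂ) (⟨x₁, y⟩ : ℂ) := by
    apply Complex.ext
    · simp; linarith
    · simp
  have hpos : 0 < ‖xi ⟨x₂, y⟩‖ := norm_pos_iff.mpr (xi_ne_zero (by simp only; linarith))
  rw [hF, norm_div, e, norm_xi_conj (by simpa using hx), div_le_one hpos] at hmain
  exact hmain

/-! ### Growth of the completed zeta function for real parts between 3/2 and 2 -/

theorem mk_ne_zero {x y : ℝ} (hy : y ≠ 0) : (⟨x, y⟩ : ℂ) ≠ 0 := fun h ↦ hy (congrArg im h)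

theorem log_norm_mk_sub_le {u v y : ℝ} (hu : 0 ≤ u) (huv : u ≤ v) (hy : 65 < y) :
    Real.log ‖(⟨v, y⟩ : ℂ)‖ - Real.log ‖(⟨u, y⟩ : ℂ)‖ ≤ (v - u) * v / 4225 := by
  have hlog (x : ℝ) : Real.log ‖(⟨x, y⟩ : ℂ)‖ = Real.log (x * x + y * y) / 2 := by
    rw [← normSq_mk, normSq_eq_norm_sq, Real.log_pow]
    push_cast
    ring
  have hpos (x : ℝ) : 0 < x * x + y * y := by nlinarith [mul_self_nonneg x]
  have h := Real.log_le_sub_one_of_pos (div_pos (hpos v) (hpos u))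
  rw [Real.log_div (hpos v).ne' (hpos u).ne', div_sub_one (hpos u).ne'] at h
  have h2 : (v * v + y * y - (u * u + y * y)) / (u * u + y * y) ≤ (v - u) * (2 * v) / 4225 := by
    rw [div_le_div_iff₀ (hpos u) (by norm_num)]
    have hA : v * v + y * y - (u * u + y * y) ≤ (v - u) * (2 * v) := by nlinarith
    have hB : (4225 : ℝ) ≤ u * u + y * y := by nlinarith
    have hC : 0 ≤ (v - u) * (2 * v) := mul_nonneg (by linarith) (by linarith)
    calc _ ≤ (v - u) * (2 * v) * 4225 := by gcongr
      _ ≤ _ := by gcongr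
  rw [hlog, hlog]
  linarith

theorem div_le_log_sub {u v : ℝ} (hu : 0 < u) (huv : u ≤ v) :
    (v - u) / v ≤ Real.log v - Real.log u := by
  have hv : 0 < v := by linarith
  have h := Real.one_sub_inv_le_log_of_pos (div_pos hv hu)
  rw [Real.log_div hv.ne' hu.ne', inv_div, one_sub_div hv.ne'] at h
  exact h

theorem log_sub_le_div {u v : ℝ} (hu : 0 < u) (huv : u ≤ v) :
    Real.log v - Real.log u ≤ (v - u) / u := by
  have hv : 0 < v := by linarith
  have h := Real.log_le_sub_one_of_pos (div_pos hv hu)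
  rwa [Real.log_div hv.ne' hu.ne', div_sub_one hu.ne'] at h

/-- The recursion `Γ(w + 1) = w Γ(w)`, applied `n` times to `log (‖Γ(x + iy)‖ / Γ(x))`. -/
theorem log_norm_Gamma_sub_eq {x y : ℝ} (hx : 0 < x) (n : ℕ) :
    Real.log ‖Gamma ⟨x, y⟩‖ - Real.log ‖Gamma x‖
      = Real.log ‖Gamma ⟨x + n, y⟩‖ - Real.log ‖Gamma (x + n : ℝ)‖
        + ∑ k ∈ Finset.range n, (Real.log (x + k) - Real.log ‖(⟨x + k, y⟩ : ℂ)‖) := by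
  induction n with
  | zero => simp
  | succ n ih =>
    have hn : (0 : ℝ) < x + n := by positivity
    have step (t : ℝ) : Real.log ‖Gamma ⟨x + (n + 1 : ℕ), t⟩‖
        = Real.log ‖(⟨x + n, t⟩ : ℂ)‖ + Real.log ‖Gamma ⟨x + n, t⟩‖ := by
      have h0 : (⟨x + n, t⟩ : ℂ) ≠ 0 := fun h ↦ hn.ne' (congrArg re h)
      have e : (⟨x + (n + 1 : ℕ), t⟩ : ℂ) = ⟨x + n, t⟩ + 1 := by
        apply Complex.ext <;> simp [add_assoc]
      rw [e, Gamma_add_one _ h0, norm_mul, Real.log_mul (norm_ne_zero_iff.mpr h0)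
        (norm_ne_zero_iff.mpr (Gamma_ne_zero_of_re_pos hn))]
    have step0 := step 0
    have e0 : ‖(⟨x + n, 0⟩ : ℂ)‖ = x + n := by
      rw [show (⟨x + n, 0⟩ : ℂ) = ((x + n : ℝ) : ℂ) from rfl, norm_real, Real.norm_of_nonneg hn.le]
    rw [e0] at step0
    rw [ih, Finset.sum_range_succ, step y]
    change Real.log ‖Gamma ((x + (n + 1 : ℕ) : ℝ) : ℂ)‖
      = _ + Real.log ‖Gamma ((x + n : ℝ) : ℂ)‖ at step0
    rw [step0]
    ring

theorem log_norm_Gamma_sub_mono {x₁ x₂ : ℝ} (hx : 0 < x₁) (hx' : x₁ ≤ x₂) (y : ℝ) :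
    Real.log ‖Gamma ⟨x₁, y⟩‖ - Real.log ‖Gamma x₁‖
      ≤ Real.log ‖Gamma ⟨x₂, y⟩‖ - Real.log ‖Gamma x₂‖ := by
  have hne (x t : ℝ) (hx : 0 < x) : ‖Gamma ⟨x, t⟩‖ ≠ 0 :=
    norm_ne_zero_iff.mpr (Gamma_ne_zero_of_re_pos hx)
  have hx2 : 0 < x₂ := by linarith
  have hne' (x : ℝ) (hx : 0 < x) : ‖Gamma (x : ℂ)‖ ≠ 0 := hne x 0 hx
  have h := Real.log_le_log (mul_pos ((hne x₁ y hx).symm.lt_of_le (norm_nonneg _))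
    ((hne' x₂ hx2).symm.lt_of_le (norm_nonneg _))) (norm_Gamma_mul_le hx hx' y)
  rw [Real.log_mul (hne x₁ y hx) (hne' x₂ hx2), Real.log_mul (hne x₂ y hx2) (hne' x₁ hx)] at h
  linarith

/-- For large `y`, the logarithm of `‖Γ(x + iy)‖ / Γ(x)` grows faster than that of `x (x - 1)`: the
first terms of the product for `Γ` contribute about `1/x + 1/(x + 1) + ⋯` to its derivative. -/
theorem log_norm_Gamma_growth {x₁ x₂ y : ℝ} (h1 : 3 / 2 ≤ x₁) (h12 : x₁ ≤ x₂) (h2 : x₂ ≤ 2)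
    (hy : 65 < y) :
    (Real.log ‖Gamma ⟨x₁, y⟩‖ - Real.log ‖Gamma x₁‖ - Real.log x₁ - Real.log (x₁ - 1))
        + (x₂ - x₁) / 10
      ≤ Real.log ‖Gamma ⟨x₂, y⟩‖ - Real.log ‖Gamma x₂‖ - Real.log x₂ - Real.log (x₂ - 1) := by
  -- The term `k = 0` cancels `log x`, while `log (x - 1)` grows at rate at most `2`; the `23` terms
  -- `1/3 + ⋯ + 1/25 > 2.3` exceed this by more than the loss caused by `‖x + k + iy‖`.
  rw [log_norm_Gamma_sub_eq (x := x₁) (by linarith) 24,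
    log_norm_Gamma_sub_eq (x := x₂) (by linarith) 24,
    Finset.sum_range_succ' _ 23, Finset.sum_range_succ' _ 23]
  have hG := log_norm_Gamma_sub_mono (x₁ := x₁ + (24 : ℕ)) (x₂ := x₂ + (24 : ℕ))
    (by push_cast; linarith) (by linarith) y
  have hterm : ∑ k ∈ Finset.range 23,
        (Real.log (x₁ + (k + 1 : ℕ)) - Real.log ‖(⟨x₁ + (k + 1 : ℕ), y⟩ : ℂ)‖)
      + (x₂ - x₁) * ∑ k ∈ Finset.range 23, (1 / ((k : ℝ) + 3) - ((k : ℝ) + 3) / 4225)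
      ≤ ∑ k ∈ Finset.range 23,
        (Real.log (x₂ + (k + 1 : ℕ)) - Real.log ‖(⟨x₂ + (k + 1 : ℕ), y⟩ : ℂ)‖) := by
    rw [Finset.mul_sum, ← Finset.sum_add_distrib]
    refine Finset.sum_le_sum fun k _ ↦ ?_
    have hk : (0 : ℝ) ≤ k := k.cast_nonneg
    push_cast
    have a := div_le_log_sub (u := x₁ + (k + 1)) (v := x₂ + (k + 1)) (by linarith) (by linarith)
    have b := log_norm_mk_sub_le (u := x₁ + (k + 1)) (v := x₂ + (k + 1)) (by linarith)
      (by linarith) hy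
    have c : (x₂ - x₁) / ((k : ℝ) + 3) ≤ (x₂ + (k + 1) - (x₁ + (k + 1))) / (x₂ + (k + 1)) := by
      rw [add_sub_add_right_eq_sub]
      exact div_le_div_of_nonneg_left (by linarith) (by linarith) (by linarith)
    have d : (x₂ + (k + 1) - (x₁ + (k + 1))) * (x₂ + (k + 1)) / 4225
        ≤ (x₂ - x₁) * (((k : ℝ) + 3) / 4225) := by
      rw [add_sub_add_right_eq_sub, mul_div_assoc]
      exact mul_le_mul_of_nonneg_left (by linarith) (by linarith)
    rw [mul_sub, mul_one_div]
    linarith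
  have hnum : (21 / 10 + 2 / 100 : ℝ)
      ≤ ∑ k ∈ Finset.range 23, (1 / ((k : ℝ) + 3) - ((k : ℝ) + 3) / 4225) := by
    norm_num [Finset.sum_range_succ]
  have hd : (x₂ - x₁) * (21 / 10 + 2 / 100) ≤ (x₂ - x₁)
      * ∑ k ∈ Finset.range 23, (1 / ((k : ℝ) + 3) - ((k : ℝ) + 3) / 4225) := by
    gcongr
  have e := log_sub_le_div (u := x₁ - 1) (v := x₂ - 1) (by linarith) (by linarith)
  have e' : (x₂ - 1 - (x₁ - 1)) / (x₁ - 1) ≤ (x₂ - x₁) * 2 := by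
    rw [div_le_iff₀ (by linarith)]
    nlinarith
  have f := log_norm_mk_sub_le (u := x₁) (v := x₂) (by linarith) h12 hy
  have f' : (x₂ - x₁) * x₂ / 4225 ≤ (x₂ - x₁) * 2 / 4225 := by
    gcongr
  simp only [Nat.cast_zero, add_zero]
  linear_combination hG + hterm + hd + e + e' + f + f' + (1 / 50 - 2 / 4225) * h12

theorem log_norm_Λ_eq {x y : ℝ} (hx : 1 < x) : Real.log ‖thetaPair.Λ ⟨x, y⟩‖
    = Real.log ‖Gamma ⟨x, y⟩‖ + Real.log ‖zeta ⟨x, y⟩‖ - x * Real.log Real.pi := by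
  have hw : 1 < (⟨x, y⟩ : ℂ).re := hx
  have hG : Gamma ⟨x, y⟩ ≠ 0 := Gamma_ne_zero_of_re_pos (by simp only; linarith)
  have h := congrArg Real.log (norm_Gamma_mul_zeta (ne_zero_of_one_lt_re hw)
    (ne_one_of_one_lt_re hw) hG)
  rw [Real.log_mul (norm_ne_zero_iff.mpr hG) (norm_ne_zero_iff.mpr (zeta_ne_zero hw)),
    Real.log_mul (Real.rpow_pos_of_pos Real.pi_pos _).ne' (norm_ne_zero_iff.mpr (Λ_ne_zero hw)),
    Real.log_rpow Real.pi_pos] at h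
  simp only at h
  linarith

theorem log_norm_xi_eq {x y : ℝ} (hx : 1 < x) : Real.log ‖xi ⟨x, y⟩‖
    = Real.log ‖(⟨x, y⟩ : ℂ)‖ + Real.log ‖(⟨x - 1, y⟩ : ℂ)‖
      + Real.log ‖thetaPair.Λ ⟨x, y⟩‖ := by
  have hw : 1 < (⟨x, y⟩ : ℂ).re := hx
  have hw0 := ne_zero_of_one_lt_re hw
  have hw1 := ne_one_of_one_lt_re hw
  have e : (⟨x, y⟩ : ℂ) - 1 = ⟨x - 1, y⟩ := by apply Complex.ext <;> simp
  have h1 : (⟨x - 1, y⟩ : ℂ) ≠ 0 := e ▸ sub_ne_zero.mpr hw1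
  rw [xi_eq hw0 hw1, e, norm_mul, norm_mul, Real.log_mul (mul_ne_zero (norm_ne_zero_iff.mpr hw0)
    (norm_ne_zero_iff.mpr h1)) (norm_ne_zero_iff.mpr (Λ_ne_zero hw)),
    Real.log_mul (norm_ne_zero_iff.mpr hw0) (norm_ne_zero_iff.mpr h1)]

theorem log_norm_xi_mono {x₁ x₂ : ℝ} (hx : 1 < x₁) (hx' : x₁ < x₂) (y : ℝ) :
    Real.log ‖xi ⟨x₁, y⟩‖ ≤ Real.log ‖xi ⟨x₂, y⟩‖ :=
  Real.log_le_log (norm_pos_iff.mpr (xi_ne_zero hx)) (norm_xi_mono hx hx' y)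

/-- The ratio of the values of `ζ(Δ, ·)` at `x₂ + iy` and `x₁ + iy` is at least the ratio at `x₂`
and `x₁`, which is bounded below by the monotonicity of `xi` on the real axis; the powers of `π`
cancel, and the Gamma factors decide. -/
theorem log_norm_Λ_growth {x₁ x₂ y : ℝ} (h1 : 3 / 2 ≤ x₁) (h12 : x₁ < x₂) (h2 : x₂ ≤ 2)
    (hy : 65 < y) :
    Real.log ‖thetaPair.Λ ⟨x₁, y⟩‖ + (x₂ - x₁) / 10 ≤ Real.log ‖thetaPair.Λ ⟨x₂, y⟩‖ := by
  have hx1 : 1 < x₁ := by linarith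
  have hx2 : 1 < x₂ := by linarith
  have hxi := log_norm_xi_mono hx1 h12 0
  have hreal (x : ℝ) (hx : 0 ≤ x) : ‖(⟨x, 0⟩ : ℂ)‖ = x := by
    rw [show (⟨x, 0⟩ : ℂ) = (x : ℂ) from rfl, norm_real, Real.norm_of_nonneg hx]
  rw [log_norm_xi_eq hx1, log_norm_xi_eq hx2, log_norm_Λ_eq hx1, log_norm_Λ_eq hx2,
    hreal _ (by linarith), hreal _ (by linarith), hreal _ (by linarith),
    hreal _ (by linarith)] at hxi
  change _ + (Real.log ‖Gamma (x₁ : ℂ)‖ + Real.log ‖zeta (x₁ : ℂ)‖ - _)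
    ≤ _ + (Real.log ‖Gamma (x₂ : ℂ)‖ + Real.log ‖zeta (x₂ : ℂ)‖ - _) at hxi
  have hne (x y : ℝ) (hx : 1 < x) : ‖zeta ⟨x, y⟩‖ ≠ 0 := norm_ne_zero_iff.mpr (zeta_ne_zero hx)
  have hne' (x : ℝ) (hx : 1 < x) : ‖zeta (x : ℂ)‖ ≠ 0 := hne x 0 hx
  have hZ := Real.log_le_log (mul_pos ((hne x₁ y hx1).symm.lt_of_le (norm_nonneg _))
    ((hne' x₂ hx2).symm.lt_of_le (norm_nonneg _))) (norm_zeta_mul_le hx1 h12.le y)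
  rw [Real.log_mul (hne x₁ y hx1) (hne' x₂ hx2), Real.log_mul (hne x₂ y hx2) (hne' x₁ hx1)] at hZ
  have hG := log_norm_Gamma_growth h1 h12.le h2 hy
  rw [log_norm_Λ_eq hx1, log_norm_Λ_eq hx2]
  linarith

/-! ### The quotients in terms of the completed zeta function -/

theorem Gamma_ne_zero_of_im_ne_zero {w : ℂ} (hw : w.im ≠ 0) : Gamma w ≠ 0 :=
  Gamma_ne_zero fun m h ↦ hw (by rw [h]; simp)

theorem Gamma_mul_zeta_of_im_ne_zero {w : ℂ} (hw : w.im ≠ 0) :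
    Gamma w * zeta w = (Real.pi : ℂ) ^ w * thetaPair.Λ w :=
  Gamma_mul_zeta (by rintro rfl; simp at hw) (by rintro rfl; simp at hw)
    (Gamma_ne_zero_of_im_ne_zero hw)

theorem Omega_eq {s : ℂ} (hs : s.im ≠ 0) :
    Omega s = Real.pi / 3 * (s * (s - 1)) * thetaPair.Λ (2 - s) := by
  have hpi : (Real.pi : ℂ) ≠ 0 := by simp [Real.pi_ne_zero]
  have h := Gamma_mul_zeta_of_im_ne_zero (w := s - 1) (by simpa using hs)
  have hG := Gamma_add_one (s - 1) (by rintro h; rw [sub_eq_zero] at h; simp [h] at hs)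
  rw [sub_add_cancel] at hG
  have hpow : (Real.pi : ℂ) ^ (2 - s) * (Real.pi : ℂ) ^ (s - 1) = Real.pi := by
    rw [← cpow_add _ _ hpi, show 2 - s + (s - 1) = (1 : ℂ) by ring, cpow_one]
  rw [← Λ_one_sub (s - 1), show 1 - (s - 1) = 2 - s by ring] at h
  rw [Omega, hG]
  linear_combination (1 / 3 * s * (s - 1) * (Real.pi : ℂ) ^ (2 - s)) * h
    + (1 / 3 * s * (s - 1) * thetaPair.Λ (2 - s)) * hpow

theorem Omega_ne_zero {s : ℂ} (hs : s.im ≠ 0) (hs' : s.re < 1) : Omega s ≠ 0 := by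
  have hpi : (Real.pi : ℂ) ≠ 0 := by simp [Real.pi_ne_zero]
  rw [Omega_eq hs]
  refine mul_ne_zero (mul_ne_zero (div_ne_zero hpi (by norm_num)) (mul_ne_zero ?_ ?_))
    (Λ_ne_zero (by simp; linarith))
  · rintro rfl; simp at hs
  · intro h; rw [sub_eq_zero] at h; simp [h] at hs

theorem norm_Λ_conj {w : ℂ} (hw : 1 < w.re) :
    ‖thetaPair.Λ ((starRingEnd ℂ) w)‖ = ‖thetaPair.Λ w‖ := by
  have h (v : ℂ) (hv : 1 < v.re) := norm_Gamma_mul_zeta (ne_zero_of_one_lt_re hv)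
    (ne_one_of_one_lt_re hv) (Gamma_ne_zero_of_re_pos (by linarith))
  have h' := h ((starRingEnd ℂ) w) (by simpa using hw)
  rw [norm_zeta_conj (ne_one_of_one_lt_re hw), Gamma_conj, norm_conj, h w hw, conj_re] at h'
  exact (mul_left_cancel₀ (Real.rpow_pos_of_pos Real.pi_pos _).ne' h').symm

theorem norm_Λ_two_sub {a b : ℝ} (ha : a < 1) :
    ‖thetaPair.Λ (2 - (⟨a, b⟩ : ℂ))‖ = ‖thetaPair.Λ ⟨2 - a, b⟩‖ := by
  rw [← norm_Λ_conj (w := ⟨2 - a, b⟩) (by simp only; linarith)]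
  congr 2
  apply Complex.ext <;> simp

theorem norm_Omega_div {a b : ℝ} (ha : a < 1) (hb : b ≠ 0) :
    ‖Omega (1 - (⟨a, b⟩ : ℂ)) / Omega ⟨a, b⟩‖
      = ‖thetaPair.Λ ⟨1 + a, b⟩‖ / ‖thetaPair.Λ ⟨2 - a, b⟩‖ := by
  have e : (2 : ℂ) - (1 - ⟨a, b⟩) = ⟨1 + a, b⟩ := by
    apply Complex.ext
    · simp; ring
    · simp
  have hpi : (Real.pi : ℂ) ≠ 0 := by simp [Real.pi_ne_zero]
  have h0 : (⟨a, b⟩ : ℂ) ≠ 0 := mk_ne_zero hb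
  have h1 : (⟨a, b⟩ : ℂ) - 1 ≠ 0 := fun h ↦ hb (by simpa using congrArg im h)
  rw [Omega_eq (by simpa using hb), Omega_eq (s := ⟨a, b⟩) hb, e, ← norm_Λ_two_sub ha, ← norm_div]
  congr 1
  rw [show (1 - (⟨a, b⟩ : ℂ)) * (1 - ⟨a, b⟩ - 1) = (⟨a, b⟩ : ℂ) * ((⟨a, b⟩ : ℂ) - 1) by ring]
  exact mul_div_mul_left _ _ (mul_ne_zero (div_ne_zero hpi (by norm_num)) (mul_ne_zero h0 h1))

theorem rho_eq {a b : ℝ} (ha0 : 0 < a) (ha : a < 1) (hb : b ≠ 0) :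
    rho ⟨a, b⟩ = Real.pi ^ 2 * ‖thetaPair.Λ ⟨2 - a, b⟩‖
      / (‖thetaPair.Λ ⟨1 + a, b⟩‖ * (‖(⟨1 - a, b⟩ : ℂ)‖ * ‖(⟨a, b⟩ : ℂ)‖)) := by
  set s : ℂ := ⟨a, b⟩ with hs
  have hpi : (Real.pi : ℂ) ≠ 0 := by simp [Real.pi_ne_zero]
  have hs0 : s ≠ 0 := mk_ne_zero hb
  have hs1 : 1 - s ≠ 0 := fun h ↦ hb (by simpa [hs] using congrArg im h)
  -- The functional equation `Λ(-s) = Λ(1 + s)` and two steps of the recursion of `Γ`.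
  have h1 := Gamma_mul_zeta_of_im_ne_zero (w := -s) (by simpa [hs] using hb)
  have h2 := Gamma_mul_zeta_of_im_ne_zero (w := 2 - s) (by simpa [hs] using hb)
  have hG1 := Gamma_add_one (-s) (neg_ne_zero.mpr hs0)
  have hG2 := Gamma_add_one (1 - s) hs1
  rw [show -s + 1 = 1 - s by ring] at hG1
  rw [show 1 - s + 1 = 2 - s by ring, hG1] at hG2
  have hpow : (Real.pi : ℂ) ^ (2 - s) = Real.pi ^ 2 * (Real.pi : ℂ) ^ (-s) := by
    rw [sub_eq_add_neg, cpow_add _ _ hpi]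
    norm_cast
  have hG : Gamma (-s) ≠ 0 := Gamma_ne_zero_of_im_ne_zero (by simpa [hs] using hb)
  have hP : (Real.pi : ℂ) ^ (-s) ≠ 0 := by simp [cpow_eq_zero_iff, Real.pi_ne_zero]
  rw [← Λ_one_sub (-s), show 1 - -s = 1 + s by ring] at h1
  have key : zeta (2 - s) * (thetaPair.Λ (1 + s) * ((1 - s) * -s))
      = Real.pi ^ 2 * thetaPair.Λ (2 - s) * zeta (-s) := by
    refine mul_left_cancel₀ (mul_ne_zero hG hP) ?_
    rw [hpow, hG2] at h2
    linear_combination ((Real.pi : ℂ) ^ (-s) * thetaPair.Λ (1 + s)) * h2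
      - (Real.pi ^ 2 * (Real.pi : ℂ) ^ (-s) * thetaPair.Λ (2 - s)) * h1
  have hΛ : thetaPair.Λ (1 + s) ≠ 0 := Λ_ne_zero (by simp [hs, ha0])
  have hZ : zeta (-s) ≠ 0 := by
    intro h
    rw [h, mul_zero] at h1
    exact mul_ne_zero hP hΛ h1.symm
  have e1 : 1 + s = ⟨1 + a, b⟩ := by apply Complex.ext <;> simp [hs]
  have e2 : ‖1 - s‖ = ‖(⟨1 - a, b⟩ : ℂ)‖ := by
    rw [← norm_conj (⟨1 - a, b⟩ : ℂ)]
    congr 1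
    apply Complex.ext <;> simp [hs]
  have hquot : zeta (2 - s) / zeta (-s) = Real.pi ^ 2 * thetaPair.Λ (2 - s)
      / (thetaPair.Λ (1 + s) * ((1 - s) * -s)) := by
    rw [div_eq_div_iff hZ (mul_ne_zero hΛ (mul_ne_zero hs1 (neg_ne_zero.mpr hs0)))]
    exact key
  rw [rho, hquot, norm_div, norm_mul, norm_mul, norm_mul, norm_neg, norm_pow, norm_real,
    Real.norm_of_nonneg Real.pi_pos.le, e1, e2, norm_Λ_two_sub ha]

theorem eta_eq_rho {a b : ℝ} (hb : b ≠ 0) : eta ⟨a, b⟩ = rho ⟨1 - a, b⟩ := by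
  have hne (x : ℝ) : (⟨x, b⟩ : ℂ) ≠ 1 := fun h ↦ hb (congrArg im h)
  have e1 : (2 : ℂ) - ⟨1 - a, b⟩ = (starRingEnd ℂ) (⟨a + 1, b⟩ : ℂ) := by
    apply Complex.ext
    · simp; ring
    · simp
  have e2 : -(⟨1 - a, b⟩ : ℂ) = (starRingEnd ℂ) (⟨a - 1, b⟩ : ℂ) := by
    apply Complex.ext <;> simp
  have e3 : (⟨a, b⟩ : ℂ) + 1 = ⟨a + 1, b⟩ := by apply Complex.ext <;> simp
  have e4 : (⟨a, b⟩ : ℂ) - 1 = ⟨a - 1, b⟩ := by apply Complex.ext <;> simp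
  rw [eta, rho, norm_div, norm_div, e1, e2, e3, e4, norm_zeta_conj (hne _), norm_zeta_conj (hne _)]

/-- The logarithm of `‖Omega (1 - s) / Omega s‖` at `s = a + ib`. -/
noncomputable def logQuot (b a : ℝ) : ℝ :=
  Real.log ‖thetaPair.Λ ⟨1 + a, b⟩‖ - Real.log ‖thetaPair.Λ ⟨2 - a, b⟩‖

theorem logQuot_one_sub (b a : ℝ) : logQuot b (1 - a) = -logQuot b a := by
  rw [logQuot, logQuot, show 1 + (1 - a) = 2 - a by ring, show 2 - (1 - a) = 1 + a by ring]
  ring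

theorem norm_Λ_pos {x : ℝ} (hx : 1 < x) (b : ℝ) : 0 < ‖thetaPair.Λ ⟨x, b⟩‖ :=
  norm_pos_iff.mpr (Λ_ne_zero hx)

theorem norm_Omega_div_eq_exp {a b : ℝ} (ha0 : 0 < a) (ha : a < 1) (hb : b ≠ 0) :
    ‖Omega (1 - (⟨a, b⟩ : ℂ)) / Omega ⟨a, b⟩‖ = Real.exp (logQuot b a) := by
  rw [norm_Omega_div ha hb, logQuot, Real.exp_sub, Real.exp_log (norm_Λ_pos (by linarith) b),
    Real.exp_log (norm_Λ_pos (by linarith) b)]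

theorem rho_eq_exp {a b : ℝ} (ha0 : 0 < a) (ha : a < 1) (hb : b ≠ 0) :
    rho ⟨a, b⟩ = Real.pi ^ 2 * Real.exp (-(logQuot b a + Real.log ‖(⟨1 - a, b⟩ : ℂ)‖
      + Real.log ‖(⟨a, b⟩ : ℂ)‖)) := by
  rw [rho_eq ha0 ha hb, logQuot, Real.exp_neg, Real.exp_add, Real.exp_add, Real.exp_sub,
    Real.exp_log (norm_Λ_pos (by linarith) b), Real.exp_log (norm_Λ_pos (by linarith) b),
    Real.exp_log (norm_pos_iff.mpr (mk_ne_zero hb)),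
    Real.exp_log (norm_pos_iff.mpr (mk_ne_zero hb))]
  have := (norm_Λ_pos (x := 2 - a) (by linarith) b).ne'
  field_simp

/-- At `1 + s` the monotonicity of `xi` costs only the growth of `‖s (1 + s)‖`, which is dominated
by the growth of the completed zeta function at `2 - s`. -/
theorem logQuot_growth {a₁ a₂ b : ℝ} (h0 : 0 < a₁) (h12 : a₁ < a₂) (h2 : a₂ ≤ 1 / 2)
    (hb : 65 < b) : logQuot b a₁ + (a₂ - a₁) / 20 ≤ logQuot b a₂ := by
  -- The reflection `a ↦ 2 - a` puts `(0, 1/2]` into `[3/2, 2)`, where the growth estimate applies.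
  have hΛ := log_norm_Λ_growth (x₁ := 2 - a₂) (x₂ := 2 - a₁) (by linarith) (by linarith)
    (by linarith) hb
  have hxi := log_norm_xi_mono (x₁ := 1 + a₁) (x₂ := 1 + a₂) (by linarith) (by linarith) b
  rw [log_norm_xi_eq (by linarith), log_norm_xi_eq (by linarith), add_sub_cancel_left,
    add_sub_cancel_left] at hxi
  have e1 := log_norm_mk_sub_le (u := a₁) (v := a₂) h0.le h12.le hb
  have e2 := log_norm_mk_sub_le (u := 1 + a₁) (v := 1 + a₂) (by linarith) (by linarith) hb
  have e3 : (a₂ - a₁) * a₂ ≤ (a₂ - a₁) * 2 := by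
    gcongr
    linarith
  have e4 : (1 + a₂ - (1 + a₁)) * (1 + a₂) ≤ (a₂ - a₁) * 2 := by
    rw [add_sub_add_left_eq_sub]
    gcongr
    linarith
  rw [logQuot, logQuot]
  linarith

theorem strictMonoOn_logQuot {b : ℝ} (hb : 65 < b) : StrictMonoOn (logQuot b) (Ioo 0 1) := by
  have hl : StrictMonoOn (logQuot b) (Ioc 0 (1 / 2)) := fun a₁ h1 a₂ h2 h12 ↦ by
    have := logQuot_growth h1.1 h12 h2.2 hb
    linarith
  have hr : StrictMonoOn (logQuot b) (Ico (1 / 2) 1) := fun a₁ h1 a₂ h2 h12 ↦ by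
    have h := hl (a := 1 - a₂) (b := 1 - a₁) ⟨by linarith [h2.2], by linarith [h2.1]⟩
      ⟨by linarith [h1.2], by linarith [h1.1]⟩ (by linarith)
    rw [logQuot_one_sub, logQuot_one_sub] at h
    linarith
  rw [← Ioc_union_Ico_eq_Ioo (a := (0 : ℝ)) (b := 1 / 2) (c := 1) (by norm_num) (by norm_num)]
  exact hl.union hr (isGreatest_Ioc (by norm_num)) (isLeast_Ico (by norm_num))

theorem strictAntiOn_rho {b : ℝ} (hb : 65 < b) :
    StrictAntiOn (fun a : ℝ ↦ rho ⟨a, b⟩) (Ioo 0 (1 / 2)) := by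
  intro a₁ h1 a₂ h2 h12
  have hb0 : b ≠ 0 := by linarith
  obtain ⟨h1l, h1r⟩ := h1
  obtain ⟨h2l, h2r⟩ := h2
  beta_reduce
  rw [rho_eq_exp h1l (by linarith) hb0, rho_eq_exp h2l (by linarith) hb0]
  refine mul_lt_mul_of_pos_left (Real.exp_lt_exp.mpr (neg_lt_neg ?_)) (by positivity)
  have hQ := logQuot_growth h1l h12 h2r.le hb
  have e1 := log_norm_mk_sub_le (u := 1 - a₂) (v := 1 - a₁) (by linarith) (by linarith) hb
  have e2 : (1 - a₁ - (1 - a₂)) * (1 - a₁) ≤ (a₂ - a₁) * 1 := by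
    rw [sub_sub_sub_cancel_left]
    gcongr
    linarith
  have e3 := Real.log_le_log (norm_pos_iff.mpr (mk_ne_zero hb0)) (norm_mk_le h1l.le h12.le b)
  linarith

end TorusZeta

theorem proposition4p5 :
    -- the quotient is well defined, and has modulus one on the critical line only
    (∀ s : ℂ, 0 < s.re → s.re < 1 → 65 < s.im →
      TorusZeta.Omega s ≠ 0 ∧ TorusZeta.Omega (1 - s) ≠ 0 ∧
      (‖TorusZeta.Omega (1 - s) / TorusZeta.Omega s‖ = 1 ↔ s.re = 1 / 2)) ∧
    -- strict monotonicity in the real part, for each fixed imaginary part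
    (∀ b : ℝ, 65 < b →
      StrictMonoOn (fun a : ℝ ↦ ‖TorusZeta.Omega (1 - (⟨a, b⟩ : ℂ)) / TorusZeta.Omega ⟨a, b⟩‖)
        (Set.Ioo 0 1) ∧
      StrictAntiOn (fun a : ℝ ↦ TorusZeta.rho ⟨a, b⟩) (Set.Ioo 0 (1 / 2)) ∧
      StrictMonoOn (fun a : ℝ ↦ TorusZeta.eta ⟨a, b⟩) (Set.Ioo (1 / 2) 1)) := by
  refine ⟨?_, fun b hb ↦ ⟨fun a₁ h1 a₂ h2 h12 ↦ ?_, TorusZeta.strictAntiOn_rho hb,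
    fun a₁ h1 a₂ h2 h12 ↦ ?_⟩⟩
  · rintro ⟨a, b⟩ ha0 ha1 hb
    dsimp only at ha0 ha1 hb ⊢
    have hb0 : b ≠ 0 := by linarith
    refine ⟨TorusZeta.Omega_ne_zero hb0 ha1,
      TorusZeta.Omega_ne_zero (by simpa using hb0) (by simpa using ha0), ?_⟩
    have hhalf : TorusZeta.logQuot b (1 / 2) = 0 := by
      have h := TorusZeta.logQuot_one_sub b (1 / 2)
      rw [show (1 : ℝ) - 1 / 2 = 1 / 2 by norm_num] at h
      linarith
    rw [TorusZeta.norm_Omega_div_eq_exp ha0 ha1 hb0, Real.exp_eq_one_iff, ← hhalf]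
    exact (TorusZeta.strictMonoOn_logQuot hb).injOn.eq_iff ⟨ha0, ha1⟩ (by norm_num)
  · have hb0 : b ≠ 0 := by linarith
    beta_reduce
    rw [TorusZeta.norm_Omega_div_eq_exp h1.1 h1.2 hb0,
      TorusZeta.norm_Omega_div_eq_exp h2.1 h2.2 hb0]
    exact Real.exp_lt_exp.mpr (TorusZeta.strictMonoOn_logQuot hb h1 h2 h12)
  · have hb0 : b ≠ 0 := by linarith
    beta_reduce
    rw [TorusZeta.eta_eq_rho hb0, TorusZeta.eta_eq_rho hb0]
    have h1' : 1 - a₁ ∈ Set.Ioo (0 : ℝ) (1 / 2) := ⟨by linarith [h1.2], by linarith [h1.1]⟩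
    have h2' : 1 - a₂ ∈ Set.Ioo (0 : ℝ) (1 / 2) := ⟨by linarith [h2.2], by linarith [h2.1]⟩
    exact TorusZeta.strictAntiOn_rho hb h2' h1' (by linarith)
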